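/- Let $X_1(t)=\frac{1}{1-\ln t}$ and $X_{k+1}(t)=X_k(X_1(t))$ for $t\in(0,1]$, $k\ge 1$. There is a unique $\kappa>1$ such that \[ \sum_{i=1}^{\infty}X_1(1/\kappa)\cdots X_i(1/\kappa)=\frac14 . \] With this $\kappa$, for every integer $n\ge 2$ there exists $\sigma_n>0$, depending only on $n$, with the following property. Let $\Omega\subset\mathbb{R}^n$ be a bounded domain with $0\in\partial\Omega$, put $D=\sup_{x\in\Omega}|x|$, and assume that $\Omega$ satisfies an exterior ball condition at $0$ with radius $\rho>0$, that is, $B_\rho(-\rho\nu)\subset\mathbb{R}^n\setminus\overline{\Omega}$ for some unit vector $\nu$. If $\rho\ge D/\sigma_n$, then, writing $X_i=X_i(|x|/(3\kappa D))$, \[ \int_\Omega|\nabla u|^2\,dx\;\ge\;\frac{n^2}{4}\int_\Omega\frac{u^2}{|x|^2}\,dx+\frac14\sum_{i=1}^{\infty}\int_\Omega\frac{u^2}{|x|^2}X_1^2\cdots X_i^2\,dx\qquad\text{for all }u\in C_c^\infty(\Omega), \] where the series on the right converges. If in addition $\Omega$ satisfies an interior ball condition at $0$ (that is, $B_r(r\nu')\subset\Omega$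 for some $r>0$ and some unit vector $\nu'$), then the constants $1/4$ are sharp at each step: for every integer $m\ge1$, \[ \inf_{0\ne u\in C_c^\infty(\Omega)}\frac{\displaystyle\int_\Omega|\nabla u|^2dx-\frac{n^2}{4}\int_\Omega\frac{u^2}{|x|^2}dx-\frac14\sum_{i=1}^{m-1}\int_\Omega\frac{u^2}{|x|^2}X_1^2\cdots X_i^2dx}{\displaystyle\int_\Omega\frac{u^2}{|x|^2}X_1^2\cdots X_m^2dx}=\frac14 \] (for $m=1$ the sum over $i$ is empty). -/

import Mathlib

open MeasureTheory
open scoped ContDiff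

noncomputable section

namespace HardyBoundary

/-- The logarithmic function `X₁(t) = 1 / (1 - ln t)`, meant for `t ∈ (0, 1]`. -/
def X₁ (t : ℝ) : ℝ := 1 / (1 - Real.log t)

/-- The iterated logarithms: `X 1 = X₁` and `X (k + 1) t = X k (X₁ t)`.
Only the indices `k ≥ 1` are used. -/
def X : ℕ → ℝ → ℝ
  | 0, t => t
  | k + 1, t => X k (X₁ t)

/-- `κ > 1` and `∑_{i ≥ 1} X_1(1/κ) ⋯ X_i(1/κ) = 1/4` (the series converges with this sum). -/
def IsKappa (κ : ℝ) : Prop :=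
  1 < κ ∧ HasSum (fun i : ℕ => ∏ j ∈ Finset.Icc 1 (i + 1), X j (1 / κ)) (1 / 4)

variable {n : ℕ}

/-- `u ∈ C_c^∞(Ω)`, real valued. -/
def IsTestFunction (Ω : Set (EuclideanSpace ℝ (Fin n))) (u : EuclideanSpace ℝ (Fin n) → ℝ) :
    Prop :=
  ContDiff ℝ ∞ u ∧ HasCompactSupport u ∧ tsupport u ⊆ Ω

/-- A bounded domain: a nonempty, open, connected and bounded set. -/
def IsBoundedDomain (Ω : Set (EuclideanSpace ℝ (Fin n))) : Prop :=
  IsOpen Ω ∧ IsConnected Ω ∧ Bornology.IsBounded Ω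

/-- An exterior ball at `0` of radius `ρ`: for some unit vector `ν`, the ball of radius `ρ`
centered at `-ρ ν` lies in the complement of the closure of `Ω`. -/
def HasExteriorBall (Ω : Set (EuclideanSpace ℝ (Fin n))) (ρ : ℝ) : Prop :=
  0 < ρ ∧ ∃ ν : EuclideanSpace ℝ (Fin n), ‖ν‖ = 1 ∧ Metric.ball (-(ρ • ν)) ρ ⊆ (closure Ω)ᶜ

/-- The interior ball condition at `0`: some ball contained in `Ω` has `0` on its boundary. -/
def HasInteriorBall (Ω : Set (EuclideanSpace ℝ (Fin n))) : Prop :=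
  ∃ r : ℝ, 0 < r ∧ ∃ ν : EuclideanSpace ℝ (Fin n), ‖ν‖ = 1 ∧ Metric.ball (r • ν) r ⊆ Ω

/-- `D = sup_{x ∈ Ω} |x|`. -/
def supNorm (Ω : Set (EuclideanSpace ℝ (Fin n))) : ℝ :=
  sSup ((fun x => ‖x‖) '' Ω)

/-- `∫_Ω |∇u|² dx`. -/
def dirichlet (Ω : Set (EuclideanSpace ℝ (Fin n))) (u : EuclideanSpace ℝ (Fin n) → ℝ) : ℝ :=
  ∫ x in Ω, ‖gradient u x‖ ^ 2

/-- `∫_Ω u² / |x|² dx`. -/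
def hardy (Ω : Set (EuclideanSpace ℝ (Fin n))) (u : EuclideanSpace ℝ (Fin n) → ℝ) : ℝ :=
  ∫ x in Ω, u x ^ 2 / ‖x‖ ^ 2

/-- `∫_Ω (u² / |x|²) X_1² ⋯ X_i² dx` with `X_j = X_j(|x| / L)`. -/
def logHardy (Ω : Set (EuclideanSpace ℝ (Fin n))) (L : ℝ) (i : ℕ)
    (u : EuclideanSpace ℝ (Fin n) → ℝ) : ℝ :=
  ∫ x in Ω, u x ^ 2 / ‖x‖ ^ 2 * ∏ j ∈ Finset.Icc 1 i, X j (‖x‖ / L) ^ 2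

end HardyBoundary

end

namespace HardyBoundary

open Set Filter Topology

/-! ### Iterated logarithms -/

/-! The lower bound comes from completing a square: for a smooth field `T` on `Ω`, expanding `|∇u -
uT|² ≥ 0` and integrating by parts gives `∫|∇u|² ≥ ∫ -(div T + |T|²) u²`
(`integral_mul_sq_le_dirichlet`). The field used is `T = ∇ log φ` with `φ = F(w) r^{-n/2} (X_1 ⋯
X_m)^{-1/2} e^{-δr}`, `r = |x|`. In a half-space the model is `⟨ν, x⟩ r^{-n/2}`; here `⟨ν, x⟩` is
replaced by `w = ⟨ν, x⟩ + ε|x|²`, which is positive exactly outside the closed exterior ball when `ε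
= 1/(2ρ)`, and then by `F = w - nεw²/2`. Curvature produces errors of order `ε`: part of them
cancels in the product terms, and the rest is paid for by `e^{-δr}` with `δ` a multiple of `ε`. The
payment works because `η = ∑ X_1 ⋯ X_i ≤ 1/4`, which is what `κ` guarantees, and because `δr ≤ 1/4`,
which is what `σ_n` guarantees. The logarithmic terms appear through the Riccati identity `tη' = (η²
+ ∑ X_1² ⋯ X_i²)/2` (`hasDerivAt_sumX`). Everything is uniform in `m`, so the series converges and
the full inequality follows from its partial sums.

For sharpness, test functions `f(|x|) ζ(cos θ)` are placed in a cone inside the interior ball. The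
angular part approximates `max(cos θ, 0)`, whose spherical Rayleigh quotient is `n - 1`; the radial
part is `r^{1-n/2} (X_1 ⋯ X_m)^{-1/2} y(1/X_{m+1})`. Since `(n - 1) + (1 - n/2)² = n²/4`, the
leading terms cancel, and in the variable `s = 1/X_{m+1}` what remains is `1/4 ∫y² + ∫y'²`
(`integral_radial_sq`, `integral_comp_inv_X`). Spreading `y` over a long interval makes `∫y'²`
negligible. The angular error is of order `r₂`, the outer radius of the support, and it is beaten by
the logarithmic weight once the support is close to the origin (`eventually_le_prodX_sq`). -/

lemma one_le_one_sub_log {t : ℝ} (h0 : 0 < t) (h1 : t ≤ 1) : 1 ≤ 1 - Real.log t := by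
  linarith [Real.log_nonpos h0.le h1]

lemma X₁_pos {t : ℝ} (h0 : 0 < t) (h1 : t ≤ 1) : 0 < X₁ t :=
  one_div_pos.2 (by linarith [one_le_one_sub_log h0 h1])

lemma X₁_lt_one {t : ℝ} (h0 : 0 < t) (h1 : t < 1) : X₁ t < 1 := by
  have := Real.log_neg h0 h1
  unfold X₁
  rw [div_lt_one] <;> linarith

lemma X₁_le_one {t : ℝ} (h0 : 0 < t) (h1 : t ≤ 1) : X₁ t ≤ 1 := by
  have := one_le_one_sub_log h0 h1
  unfold X₁
  rw [div_le_one] <;> linarith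

lemma X₁_lt_X₁ {s t : ℝ} (h0 : 0 < s) (hst : s < t) (h1 : t ≤ 1) : X₁ s < X₁ t := by
  have := one_le_one_sub_log (h0.trans hst) h1
  have := Real.log_lt_log h0 hst
  unfold X₁
  apply one_div_lt_one_div_of_lt <;> linarith

lemma le_X₁ {t : ℝ} (h0 : 0 < t) (h1 : t ≤ 1) : t ≤ X₁ t := by
  have h := one_le_one_sub_log h0 h1
  unfold X₁
  rw [le_div_iff₀ (by linarith)]
  have := Real.log_le_sub_one_of_pos (inv_pos.2 h0)
  rw [Real.log_inv] at this
  calc t * (1 - Real.log t) ≤ t * t⁻¹ := by gcongr; linarith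
    _ = 1 := mul_inv_cancel₀ h0.ne'

lemma X_zero (t : ℝ) : X 0 t = t := rfl

lemma X_succ (k : ℕ) (t : ℝ) : X (k + 1) t = X k (X₁ t) := rfl

lemma X_one (t : ℝ) : X 1 t = X₁ t := rfl

lemma X_succ' (k : ℕ) (t : ℝ) : X (k + 1) t = X₁ (X k t) := by
  induction k generalizing t with
  | zero => rfl
  | succ k ih => rw [X_succ, ih, X_succ]

lemma X_mem_Ioc (k : ℕ) {t : ℝ} (h0 : 0 < t) (h1 : t ≤ 1) : 0 < X k t ∧ X k t ≤ 1 := by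
  induction k with
  | zero => exact ⟨h0, h1⟩
  | succ k ih => rw [X_succ']; exact ⟨X₁_pos ih.1 ih.2, X₁_le_one ih.1 ih.2⟩

lemma X_pos (k : ℕ) {t : ℝ} (h0 : 0 < t) (h1 : t ≤ 1) : 0 < X k t := (X_mem_Ioc k h0 h1).1

lemma X_le_one (k : ℕ) {t : ℝ} (h0 : 0 < t) (h1 : t ≤ 1) : X k t ≤ 1 := (X_mem_Ioc k h0 h1).2

lemma X_lt_X (k : ℕ) {s t : ℝ} (h0 : 0 < s) (hst : s < t) (h1 : t ≤ 1) : X k s < X k t := by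
  induction k with
  | zero => exact hst
  | succ k ih =>
    rw [X_succ', X_succ']
    exact X₁_lt_X₁ (X_pos k h0 (hst.le.trans h1)) ih (X_le_one k (h0.trans hst) h1)

lemma X_le_X (k : ℕ) {s t : ℝ} (h0 : 0 < s) (hst : s ≤ t) (h1 : t ≤ 1) : X k s ≤ X k t := by
  rcases hst.eq_or_lt with rfl | h
  · rfl
  · exact (X_lt_X k h0 h h1).le

lemma X₁_le_X_succ (k : ℕ) {t : ℝ} (h0 : 0 < t) (h1 : t ≤ 1) : X₁ t ≤ X (k + 1) t := by
  induction k with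
  | zero => rfl
  | succ k ih =>
    rw [X_succ']
    exact ih.trans (le_X₁ (X_pos _ h0 h1) (X_le_one _ h0 h1))

/-- The product `X_1 ⋯ X_i`. -/
noncomputable def prodX (i : ℕ) (t : ℝ) : ℝ := ∏ j ∈ Finset.Icc 1 i, X j t

/-- The sum `∑_{1 ≤ i ≤ m} X_1 ⋯ X_i`. -/
noncomputable def sumX (m : ℕ) (t : ℝ) : ℝ := ∑ i ∈ Finset.Icc 1 m, prodX i t

/-- The sum `∑_{1 ≤ i ≤ m} X_1² ⋯ X_i²`. -/
noncomputable def sumSqX (m : ℕ) (t : ℝ) : ℝ := ∑ i ∈ Finset.Icc 1 m, prodX i t ^ 2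

@[simp] lemma prodX_zero (t : ℝ) : prodX 0 t = 1 := by simp [prodX]

@[simp] lemma sumX_zero (t : ℝ) : sumX 0 t = 0 := by simp [sumX]

@[simp] lemma sumSqX_zero (t : ℝ) : sumSqX 0 t = 0 := by simp [sumSqX]

lemma prodX_succ (i : ℕ) (t : ℝ) : prodX (i + 1) t = prodX i t * X (i + 1) t :=
  Finset.prod_Icc_succ_top (by omega) _

lemma sumX_succ (m : ℕ) (t : ℝ) : sumX (m + 1) t = sumX m t + prodX (m + 1) t :=
  Finset.sum_Icc_succ_top (by omega) _

lemma sumSqX_succ (m : ℕ) (t : ℝ) : sumSqX (m + 1) t = sumSqX m t + prodX (m + 1) t ^ 2 :=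
  Finset.sum_Icc_succ_top (by omega) _

lemma prodX_succ' (i : ℕ) (t : ℝ) : prodX (i + 1) t = X₁ t * prodX i (X₁ t) := by
  induction i with
  | zero => simp [prodX_succ, X_one]
  | succ i ih => rw [prodX_succ, ih, prodX_succ, X_succ (i + 1)]; ring

lemma prodX_pos (i : ℕ) {t : ℝ} (h0 : 0 < t) (h1 : t ≤ 1) : 0 < prodX i t :=
  Finset.prod_pos fun j _ => X_pos j h0 h1

lemma prodX_le_prodX (i : ℕ) {s t : ℝ} (h0 : 0 < s) (hst : s ≤ t) (h1 : t ≤ 1) :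
    prodX i s ≤ prodX i t :=
  Finset.prod_le_prod (fun j _ => (X_pos j h0 (hst.trans h1)).le) fun j _ => X_le_X j h0 hst h1

lemma prodX_succ_lt (i : ℕ) {s t : ℝ} (h0 : 0 < s) (hst : s < t) (h1 : t ≤ 1) :
    prodX (i + 1) s < prodX (i + 1) t := by
  rw [prodX_succ, prodX_succ]
  exact mul_lt_mul' (prodX_le_prodX i h0 hst.le h1) (X_lt_X _ h0 hst h1)
    (X_pos _ h0 (hst.le.trans h1)).le (prodX_pos i (h0.trans hst) h1)

/-- Since `t ≤ X₁ t`, the iterates increase with the index, so `X₁` is the smallest factor of the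
product. -/
lemma X₁_pow_le_prodX (i : ℕ) {t : ℝ} (h0 : 0 < t) (h1 : t ≤ 1) : X₁ t ^ i ≤ prodX i t := by
  induction i with
  | zero => simp
  | succ i ih =>
    rw [prodX_succ, pow_succ]
    have := X₁_pos h0 h1
    have := prodX_pos i h0 h1
    gcongr
    exact X₁_le_X_succ i h0 h1

lemma sumX_nonneg (m : ℕ) {t : ℝ} (h0 : 0 < t) (h1 : t ≤ 1) : 0 ≤ sumX m t :=
  Finset.sum_nonneg fun i _ => (prodX_pos i h0 h1).le

lemma hasDerivAt_X₁ {t : ℝ} (h0 : 0 < t) (h1 : t < 1) : HasDerivAt X₁ (X₁ t ^ 2 / t) t := by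
  have h := one_le_one_sub_log h0 h1.le
  have := ((Real.hasDerivAt_log h0.ne').const_sub 1).inv (by linarith)
  convert! this using 1
  · ext s; simp [X₁]
  · simp [X₁]; field_simp

lemma hasDerivAt_X (k : ℕ) {t : ℝ} (h0 : 0 < t) (h1 : t < 1) :
    HasDerivAt (X (k + 1)) (prodX k t * X (k + 1) t ^ 2 / t) t := by
  induction k generalizing t with
  | zero => exact (hasDerivAt_X₁ h0 h1).congr_deriv (by simp [X_one])
  | succ k ih =>
    have hX := X₁_pos h0 h1.le
    have := (ih hX (X₁_lt_one h0 h1)).comp t (hasDerivAt_X₁ h0 h1)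
    convert! this using 1
    rw [prodX_succ', X_succ (k + 1)]
    field_simp

lemma hasDerivAt_prodX (m : ℕ) {t : ℝ} (h0 : 0 < t) (h1 : t < 1) :
    HasDerivAt (prodX m) (prodX m t * sumX m t / t) t := by
  induction m with
  | zero =>
    simp only [prodX_zero, sumX_zero, mul_zero, zero_div]
    exact (hasDerivAt_const t (1 : ℝ)).congr_of_eventuallyEq (.of_forall fun s => prodX_zero s)
  | succ m ih =>
    have := ih.mul (hasDerivAt_X m h0 h1)
    refine (this.congr_of_eventuallyEq (.of_forall fun s => prodX_succ m s)).congr_deriv ?_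
    rw [sumX_succ, prodX_succ]
    ring

/-- A Riccati identity. Adding `P = prodX (m + 1)` to `S = sumX m` raises `(S² + Q)/2` by `P(S +
P)`, which is exactly `t P'`. It is the source of the squared logarithmic terms in both halves of
the theorem. -/
lemma hasDerivAt_sumX (m : ℕ) {t : ℝ} (h0 : 0 < t) (h1 : t < 1) :
    HasDerivAt (sumX m) ((sumX m t ^ 2 + sumSqX m t) / 2 / t) t := by
  induction m with
  | zero =>
    simp only [sumSqX_zero, sumX_zero]
    refine ((hasDerivAt_const t (0 : ℝ)).congr_of_eventuallyEq
      (.of_forall fun s => sumX_zero s)).congr_deriv (by simp)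
  | succ m ih =>
    have := ih.add (hasDerivAt_prodX (m + 1) h0 h1)
    refine (this.congr_of_eventuallyEq (.of_forall fun s => sumX_succ m s)).congr_deriv ?_
    rw [sumX_succ, sumSqX_succ]
    ring

lemma contDiffAt_X (k : ℕ) {t : ℝ} (h0 : 0 < t) (h1 : t < 1) : ContDiffAt ℝ ∞ (X k) t := by
  induction k generalizing t with
  | zero => exact contDiffAt_id
  | succ k ih =>
    have hlog := one_le_one_sub_log h0 h1.le
    have h : ContDiffAt ℝ ∞ X₁ t :=
      contDiffAt_const.div (contDiffAt_const.sub (Real.contDiffAt_log.2 h0.ne')) (by linarith)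
    exact (ih (X₁_pos h0 h1.le) (X₁_lt_one h0 h1)).comp t h

lemma contDiffAt_prodX (i : ℕ) {t : ℝ} (h0 : 0 < t) (h1 : t < 1) :
    ContDiffAt ℝ ∞ (prodX i) t :=
  contDiffAt_prod fun j _ => contDiffAt_X j h0 h1

lemma contDiffAt_sumX (m : ℕ) {t : ℝ} (h0 : 0 < t) (h1 : t < 1) :
    ContDiffAt ℝ ∞ (sumX m) t :=
  ContDiffAt.sum fun i _ => contDiffAt_prodX i h0 h1

/-! ### The constant `κ` -/

/-- With `z = 1/X_k - 1` the recursion reads `z ↦ log(1 + z)`, and `log(1 + z) ≥ 2z/(z + 2)` says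
that `2/z` grows by at most `1` per step. -/
lemma inv_X_sub_one_ge (k : ℕ) {a t : ℝ} (ha : 0 < a) (h0 : 0 < t) (h1 : t < 1)
    (hat : 2 / a ≤ 1 / t - 1) : 2 / (a + k) ≤ 1 / X k t - 1 := by
  induction k with
  | zero => simpa [X_zero] using hat
  | succ k ih =>
    have hX := X_pos k h0 h1.le
    set z := 1 / X k t - 1 with hz
    have hk : 0 < a + k := by positivity
    have hz0 : 0 < z := lt_of_lt_of_le (by positivity) ih
    have h := Real.le_log_one_add_of_nonneg hz0.le
    have e : 1 / X (k + 1) t - 1 = Real.log (1 + z) := by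
      rw [X_succ', X₁, hz, one_div_one_div, add_sub_cancel, one_div, Real.log_inv]; ring
    rw [e]
    refine le_trans ?_ h
    rw [div_le_iff₀ hk] at ih
    rw [div_le_div_iff₀ (by positivity) (by positivity)]
    push_cast
    nlinarith

lemma X_le_ratio (k : ℕ) {a t : ℝ} (ha : 0 < a) (h0 : 0 < t) (h1 : t < 1)
    (hat : 2 / a ≤ 1 / t - 1) : X k t ≤ (a + k) / (a + k + 2) := by
  have h := inv_X_sub_one_ge k ha h0 h1 hat
  have hX := X_pos k h0 h1.le
  have hk : 0 < a + k := by positivity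
  rw [le_div_iff₀ (by positivity)]
  rw [le_sub_iff_add_le, le_div_iff₀ hX, div_add_one hk.ne', div_mul_eq_mul_div,
    div_le_iff₀ hk] at h
  nlinarith

/-- The bounds `(a + j)/(a + j + 2)` on the factors telescope, leaving a quadratically decaying
majorant whose sum is explicit. -/
lemma prodX_le_ratio (i : ℕ) {a t : ℝ} (ha : 0 < a) (h0 : 0 < t) (h1 : t < 1)
    (hat : 2 / a ≤ 1 / t - 1) :
    prodX i t ≤ (a + 1) * (a + 2) / ((a + i + 1) * (a + i + 2)) := by
  induction i with
  | zero => simp; rw [div_self (by positivity)]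
  | succ i ih =>
    have h := X_le_ratio (i + 1) ha h0 h1 hat
    rw [prodX_succ]
    refine (mul_le_mul ih h (X_pos _ h0 h1.le).le (by positivity)).trans_eq ?_
    push_cast
    have : 0 < a + i := by positivity
    field_simp
    ring

lemma hasSum_ratio {a : ℝ} (ha : 0 < a) :
    HasSum (fun i : ℕ => (a + 1) * (a + 2) / ((a + (i + 1 : ℕ) + 1) * (a + (i + 1 : ℕ) + 2)))
      (a + 1) := by
  rw [hasSum_iff_tendsto_nat_of_nonneg (fun i => by positivity)]
  have key : ∀ N : ℕ, ∑ i ∈ Finset.range N,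
      (a + 1) * (a + 2) / ((a + (i + 1 : ℕ) + 1) * (a + (i + 1 : ℕ) + 2))
      = (a + 1) - (a + 1) * (a + 2) / (a + 2 + N) := by
    intro N
    induction N with
    | zero => simp; field_simp; ring
    | succ N ih =>
      rw [Finset.sum_range_succ, ih]
      push_cast
      have : 0 < a + N := by positivity
      field_simp
      ring
  simp_rw [key]
  have : Tendsto (fun N : ℕ => (a + 1) * (a + 2) / (a + 2 + N)) atTop (𝓝 0) :=
    tendsto_const_nhds.div_atTop (tendsto_atTop_add_const_left _ _ tendsto_natCast_atTop_atTop)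
  simpa using tendsto_const_nhds.sub this

lemma summable_prodX {t : ℝ} (h0 : 0 < t) (h1 : t < 1) :
    Summable fun i : ℕ => prodX (i + 1) t := by
  have ha : 0 < 2 / (1 / t - 1) := by
    have : 1 < 1 / t := (one_lt_div h0).2 h1
    apply div_pos <;> linarith
  refine (hasSum_ratio ha).summable.of_nonneg_of_le (fun i => (prodX_pos _ h0 h1.le).le) fun i => ?_
  exact prodX_le_ratio (i + 1) ha h0 h1 (by simp)

/-- Intermediate value theorem for the series on `[e^{-8}, e^{-3}]`. Its continuity is a Weierstrass
M-test, the terms being dominated by their values at the right endpoint. -/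
lemma exists_isKappa : ∃ κ, IsKappa κ := by
  set f : ℝ → ℝ := fun t => ∑' i : ℕ, prodX (i + 1) t with hf
  have hlo : X₁ (Real.exp (-8)) = 1 / 9 := by rw [X₁, Real.log_exp]; norm_num
  have hhi : X₁ (Real.exp (-3)) = 1 / 4 := by rw [X₁, Real.log_exp]; norm_num
  have lt1 : ∀ s : ℝ, s < 0 → Real.exp s < 1 := fun s hs => Real.exp_lt_one_iff.2 hs
  have hcont : ContinuousOn f (Icc (Real.exp (-8)) (Real.exp (-3))) := by
    refine continuousOn_tsum (fun i t ht => ?_)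
      (summable_prodX (Real.exp_pos (-3)) (lt1 _ (by norm_num))) fun i t ht => ?_
    · exact (contDiffAt_prodX (i + 1) ((Real.exp_pos _).trans_le ht.1)
        (ht.2.trans_lt (lt1 _ (by norm_num)))).continuousAt.continuousWithinAt
    · have h0 := (Real.exp_pos _).trans_le ht.1
      have h1 := lt1 (-3) (by norm_num)
      rw [Real.norm_of_nonneg (prodX_pos _ h0 (ht.2.trans h1.le)).le]
      exact prodX_le_prodX _ h0 ht.2 h1.le
  -- The recursion gives `f(e^{-8}) = (1/9)(1 + f(1/9))`. For `t = 1/9` one has `1/t - 1 = 8`, so `a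
  -- = 1/4` is admissible and `f(1/9) ≤ 5/4`; the resulting bound is exactly `1/4`.
  have h8 : f (Real.exp (-8)) ≤ 1 / 4 := by
    have hs := summable_prodX (t := 1 / 9) (by norm_num) (by norm_num)
    have hs' : HasSum (fun i : ℕ => prodX i (1 / 9)) (∑' i : ℕ, prodX (i + 1) (1 / 9) + 1) := by
      simpa using (hasSum_nat_add_iff (f := fun i : ℕ => prodX i (1 / 9)) 1).1 hs.hasSum
    have hb : ∑' i : ℕ, prodX (i + 1) (1 / 9) ≤ 1 / 4 + 1 := by
      refine hasSum_le (fun i => ?_) hs.hasSum (hasSum_ratio (a := 1 / 4) (by norm_num))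
      exact prodX_le_ratio (i + 1) (by norm_num) (by norm_num) (by norm_num) (by norm_num)
    have : f (Real.exp (-8)) = 1 / 9 * (∑' i : ℕ, prodX (i + 1) (1 / 9) + 1) := by
      simp_rw [hf, prodX_succ', hlo]
      rw [tsum_mul_left, hs'.tsum_eq]
      simp_rw [prodX_succ']
    rw [this]; linarith
  -- The first term of the series alone is `1/4`.
  have h3 : 1 / 4 ≤ f (Real.exp (-3)) := by
    have h1 := lt1 (-3) (by norm_num)
    have := (summable_prodX (Real.exp_pos (-3)) h1).le_tsum 0
      fun i _ => (prodX_pos _ (Real.exp_pos _) h1.le).le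
    refine le_trans (le_of_eq ?_) this
    simp [prodX_succ, X_one, hhi]
  obtain ⟨t, ht, hft⟩ := intermediate_value_Icc (Real.exp_le_exp.2 (by norm_num)) hcont ⟨h8, h3⟩
  have h0 := (Real.exp_pos _).trans_le ht.1
  have h1 : t < 1 := ht.2.trans_lt (lt1 _ (by norm_num))
  refine ⟨1 / t, (one_lt_div h0).2 h1, ?_⟩
  rw [one_div_one_div, ← hft]
  exact (summable_prodX h0 h1).hasSum

lemma IsKappa.unique {κ κ' : ℝ} (h : IsKappa κ) (h' : IsKappa κ') : κ = κ' := by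
  have key : ∀ {a b : ℝ}, IsKappa a → IsKappa b → ¬ a < b := by
    intro a b ha hb hab
    have ha0 : 0 < a := one_pos.trans ha.1
    have hlt : 1 / b < 1 / a := one_div_lt_one_div_of_lt ha0 hab
    have hb0 : 0 < 1 / b := by have := ha0.trans hab; positivity
    have h1 : 1 / a ≤ 1 := (div_le_one ha0).2 ha.1.le
    exact (hasSum_lt (fun i => (prodX_succ_lt i hb0 hlt h1).le) (prodX_succ_lt 0 hb0 hlt h1)
      hb.2 ha.2).false
  exact le_antisymm (not_lt.1 (key h' h)) (not_lt.1 (key h h'))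

lemma IsKappa.sumX_le {κ : ℝ} (h : IsKappa κ) (m : ℕ) {t : ℝ} (h0 : 0 < t) (ht : t ≤ 1 / κ) :
    sumX m t ≤ 1 / 4 := by
  have hκ : 0 < κ := one_pos.trans h.1
  have h1 : 1 / κ ≤ 1 := (div_le_one hκ).2 h.1.le
  have e : sumX m (1 / κ) = ∑ i ∈ Finset.range m, prodX (i + 1) (1 / κ) := by
    induction m with
    | zero => simp
    | succ m ih => rw [sumX_succ, Finset.sum_range_succ, ih]
  calc sumX m t ≤ sumX m (1 / κ) := Finset.sum_le_sum fun i _ => prodX_le_prodX i h0 ht h1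
    _ ≤ 1 / 4 := by
      rw [e]
      exact sum_le_hasSum _ (fun i _ => (prodX_pos _ (h0.trans_le ht) h1).le) h.2

variable {n : ℕ}

/-! ### Integration by parts -/

/-- Lets coefficients that are singular at the origin or at the boundary be treated as globally
smooth once multiplied by a function supported in `Ω`. -/
lemma contDiff_mul_of_tsupport_subset {E : Type*} [NormedAddCommGroup E] [NormedSpace ℝ E]
    {k : ℕ∞ω} {u g : E → ℝ} {Ω : Set E} (hu : ContDiff ℝ k u) (hsub : tsupport u ⊆ Ω)
    (hg : ∀ x ∈ Ω, ContDiffAt ℝ k g x) : ContDiff ℝ k (fun x => u x * g x) := by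
  rw [contDiff_iff_contDiffAt]
  intro x
  by_cases hx : x ∈ tsupport u
  · exact hu.contDiffAt.mul (hg x (hsub hx))
  · have : (fun x => u x * g x) =ᶠ[𝓝 x] fun _ => 0 := by
      filter_upwards [(isClosed_tsupport u).isOpen_compl.mem_nhds hx] with y hy
      rw [image_eq_zero_of_notMem_tsupport hy, zero_mul]
    exact contDiffAt_const.congr_of_eventuallyEq this

lemma integral_fderiv_apply_eq_zero {p : EuclideanSpace ℝ (Fin n) → ℝ} (hp : ContDiff ℝ 1 p)
    (hc : HasCompactSupport p) (v : EuclideanSpace ℝ (Fin n)) : ∫ x, fderiv ℝ p x v = 0 := by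
  have hi : Integrable fun x => fderiv ℝ p x v :=
    ((hp.continuous_fderiv one_ne_zero).clm_apply continuous_const).integrable_of_hasCompactSupport
      (hc.fderiv_apply ℝ v)
  have hp' : Integrable p := hp.continuous.integrable_of_hasCompactSupport hc
  have := integral_mul_fderiv_eq_neg_fderiv_mul_of_integrable (μ := volume)
    (f := fun _ : EuclideanSpace ℝ (Fin n) => (1 : ℝ)) (g := p) (v := v)
    (by simp) (by simpa using hi) (by simpa using hp')
    (fun x _ => differentiableAt_const _) (fun x _ => hp.differentiable one_ne_zero x)
  simpa using this

/-- The integrand is the divergence of the field `p(x) x`, summed coordinate by coordinate. -/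
lemma integral_fderiv_self_add {p : EuclideanSpace ℝ (Fin n) → ℝ} (hp : ContDiff ℝ 1 p)
    (hc : HasCompactSupport p) : ∫ x, (fderiv ℝ p x x + n * p x) = 0 := by
  let b := EuclideanSpace.basisFun (Fin n) ℝ
  have hcoord : ∀ i : Fin n, ContDiff ℝ 1 fun x : EuclideanSpace ℝ (Fin n) => x i := fun i =>
    (EuclideanSpace.proj (𝕜 := ℝ) i).contDiff
  have hq : ∀ i : Fin n, ContDiff ℝ 1 fun x => p x * x i := fun i => hp.mul (hcoord i)
  have hqc : ∀ i : Fin n, HasCompactSupport fun x => p x * x i := fun i => hc.mul_right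
  have hfd : ∀ (i : Fin n) x, fderiv ℝ (fun x => p x * x i) x (b i)
      = p x + x i * fderiv ℝ p x (b i) := by
    intro i x
    have h1 : HasFDerivAt (fun x : EuclideanSpace ℝ (Fin n) => x i)
      (EuclideanSpace.proj (𝕜 := ℝ) i) x := (EuclideanSpace.proj (𝕜 := ℝ) i).hasFDerivAt
    have h2 := (hp.differentiable one_ne_zero x).hasFDerivAt.fun_mul h1
    rw [h2.fderiv]
    simp [b]
  have hsum : ∀ x, fderiv ℝ p x x + n * p x
      = ∑ i, fderiv ℝ (fun x => p x * x i) x (b i) := by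
    intro x
    simp_rw [hfd]
    rw [Finset.sum_add_distrib]
    have : fderiv ℝ p x x = ∑ i, x i * fderiv ℝ p x (b i) := by
      have := congrArg (fderiv ℝ p x) (b.sum_repr x)
      simpa only [map_sum, map_smul, smul_eq_mul, b, EuclideanSpace.basisFun_repr] using this.symm
    rw [← this]
    simp [add_comm]
  simp_rw [hsum]
  rw [integral_finsetSum]
  · exact Finset.sum_eq_zero fun i _ => integral_fderiv_apply_eq_zero (hq i) (hqc i) _
  · intro i _
    exact (((hq i).continuous_fderiv one_ne_zero).clm_apply
      continuous_const).integrable_of_hasCompactSupport ((hqc i).fderiv_apply ℝ _)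

lemma integrable_fderiv_self_add {p : EuclideanSpace ℝ (Fin n) → ℝ} (hp : ContDiff ℝ 1 p)
    (hc : HasCompactSupport p) : Integrable fun x => fderiv ℝ p x x + n * p x := by
  refine Continuous.integrable_of_hasCompactSupport
    (((hp.continuous_fderiv one_ne_zero).clm_apply continuous_id).add
      (continuous_const.mul hp.continuous)) ?_
  refine HasCompactSupport.add ?_ hc.mul_left
  refine (hc.fderiv ℝ).mono' fun x hx => ?_
  by_contra h
  exact hx (by simp [image_eq_zero_of_notMem_tsupport h])

lemma inner_gradient (u : EuclideanSpace ℝ (Fin n) → ℝ) (x y : EuclideanSpace ℝ (Fin n)) :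
    inner ℝ (gradient u x) y = fderiv ℝ u x y := by
  rw [gradient, InnerProductSpace.toDual_symm_apply]

lemma norm_gradient (u : EuclideanSpace ℝ (Fin n) → ℝ) (x : EuclideanSpace ℝ (Fin n)) :
    ‖gradient u x‖ = ‖fderiv ℝ u x‖ := by
  rw [gradient, LinearIsometryEquiv.norm_map]

lemma integrable_norm_gradient_sq {u : EuclideanSpace ℝ (Fin n) → ℝ} (hu : ContDiff ℝ 1 u)
    (hc : HasCompactSupport u) : Integrable fun x => ‖gradient u x‖ ^ 2 := by
  simp_rw [norm_gradient]
  refine Continuous.integrable_of_hasCompactSupport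
    ((hu.continuous_fderiv one_ne_zero).norm.pow 2) ?_
  exact (hc.fderiv ℝ).comp_left (g := fun A => ‖A‖ ^ 2) (by simp)

/-- A Hardy-type inequality from a vector field `α e + β x` whose divergence plus squared length is
at most `-V`. -/
lemma integral_mul_sq_le_dirichlet {Ω : Set (EuclideanSpace ℝ (Fin n))} (hΩ : MeasurableSet Ω)
    {u : EuclideanSpace ℝ (Fin n) → ℝ} (hu : IsTestFunction Ω u) (e : EuclideanSpace ℝ (Fin n))
    {α β V : EuclideanSpace ℝ (Fin n) → ℝ} (hα : ∀ x ∈ Ω, ContDiffAt ℝ 1 α x)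
    (hβ : ∀ x ∈ Ω, ContDiffAt ℝ 1 β x) (hV : IntegrableOn (fun x => V x * u x ^ 2) Ω)
    (h : ∀ x ∈ Ω, V x ≤ -(fderiv ℝ α x e + fderiv ℝ β x x + n * β x + ‖α x • e + β x • x‖ ^ 2)) :
    ∫ x in Ω, V x * u x ^ 2 ≤ dirichlet Ω u := by
  obtain ⟨hus, huc, hut⟩ := hu
  have hu1 : ContDiff ℝ 1 u := hus.of_le (by simp)
  have hu2 : ContDiff ℝ 1 fun x => u x ^ 2 := hu1.pow 2
  have hu2c : HasCompactSupport fun x => u x ^ 2 := huc.comp_left (g := fun s => s ^ 2) (by simp)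
  have hu2t : tsupport (fun x => u x ^ 2) ⊆ Ω :=
    (closure_mono fun x hx => by
      rw [Function.mem_support] at hx ⊢
      exact fun h => hx (by simp [h])).trans hut
  have hp := contDiff_mul_of_tsupport_subset hu2 hu2t hα
  have hq := contDiff_mul_of_tsupport_subset hu2 hu2t hβ
  have hpc : HasCompactSupport fun x => u x ^ 2 * α x := hu2c.mul_right
  have hqc : HasCompactSupport fun x => u x ^ 2 * β x := hu2c.mul_right
  have hpi : Integrable fun x => fderiv ℝ (fun x => u x ^ 2 * α x) x e :=
    ((hp.continuous_fderiv one_ne_zero).clm_apply continuous_const).integrable_of_hasCompactSupport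
      (hpc.fderiv_apply ℝ e)
  have hqi := integrable_fderiv_self_add hq hqc
  -- `R` is the divergence of `u² (α e + β x)`, hence has integral zero.
  set R : EuclideanSpace ℝ (Fin n) → ℝ := fun x => fderiv ℝ (fun x => u x ^ 2 * α x) x e
    + (fderiv ℝ (fun x => u x ^ 2 * β x) x x + n * (u x ^ 2 * β x)) with hR
  have hRi : Integrable R := hpi.add hqi
  have hR0 : ∫ x in Ω, R x = 0 := by
    rw [setIntegral_eq_integral_of_forall_compl_eq_zero]
    · rw [hR, integral_add hpi hqi, integral_fderiv_apply_eq_zero hp hpc,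
        integral_fderiv_self_add hq hqc, add_zero]
    · intro x hx
      have h1 : x ∉ tsupport fun x => u x ^ 2 * α x :=
        fun h => hx (hu2t (tsupport_mul_subset_left h))
      have h2 : x ∉ tsupport fun x => u x ^ 2 * β x :=
        fun h => hx (hu2t (tsupport_mul_subset_left h))
      have h3 : u x = 0 := image_eq_zero_of_notMem_tsupport fun h => hx (hut h)
      simp [hR, fderiv_of_notMem_tsupport _ h1, fderiv_of_notMem_tsupport _ h2, h3]
  have hG := integrable_norm_gradient_sq hu1 huc
  calc ∫ x in Ω, V x * u x ^ 2 ≤ ∫ x in Ω, (‖gradient u x‖ ^ 2 - R x) := by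
        refine setIntegral_mono_on hV (hG.integrableOn.sub hRi.integrableOn) hΩ fun x hx => ?_
        have hud := (hu1.differentiable one_ne_zero x).hasFDerivAt
        have hαd := ((hα x hx).differentiableAt one_ne_zero).hasFDerivAt
        have hβd := ((hβ x hx).differentiableAt one_ne_zero).hasFDerivAt
        have e1 := ((hud.pow 2).fun_mul hαd).fderiv
        have e2 := ((hud.pow 2).fun_mul hβd).fderiv
        have hsq : 0 ≤ ‖gradient u x - u x • (α x • e + β x • x)‖ ^ 2 := by positivity
        rw [norm_sub_sq_real, inner_smul_right, inner_add_right, inner_smul_right,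
          inner_smul_right, inner_gradient, inner_gradient, norm_smul, mul_pow, Real.norm_eq_abs,
          sq_abs] at hsq
        have hVx := mul_le_mul_of_nonneg_right (h x hx) (sq_nonneg (u x))
        simp only [hR, e1, e2]
        simp only [_root_.add_apply, _root_.smul_apply, smul_eq_mul,
          nsmul_eq_mul]
        norm_num
        nlinarith
    _ = dirichlet Ω u := by
        rw [integral_sub hG.integrableOn hRi.integrableOn, hR0, sub_zero, dirichlet]

/-! ### The improved Hardy inequality -/

lemma hasFDerivAt_norm {x : EuclideanSpace ℝ (Fin n)} (hx : x ≠ 0) :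
    HasFDerivAt (fun y : EuclideanSpace ℝ (Fin n) => ‖y‖) (‖x‖⁻¹ • innerSL ℝ x) x := by
  have h := (hasStrictFDerivAt_norm_sq x).hasFDerivAt.sqrt (by simpa using hx)
  refine (h.congr_of_eventuallyEq (.of_forall fun y => ?_)).congr_fderiv ?_
  · simp [Real.sqrt_sq]
  · have : ‖x‖ ≠ 0 := by simpa using hx
    ext y
    simp [Real.sqrt_sq]
    ring

lemma hasFDerivAt_inner (e x : EuclideanSpace ℝ (Fin n)) :
    HasFDerivAt (fun y : EuclideanSpace ℝ (Fin n) => inner ℝ e y) (innerSL ℝ e) x :=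
  (innerSL ℝ e).hasFDerivAt

/-- The scalar form of `Δφ/φ ≤ -(n²/4 + Q/4)/r²` for the `φ` described above. It uses `Δw = 2nε`,
`|∇w|² = 1 + 4εw` and `⟨x, ∇w⟩ = w + εr²`; `A` is minus the logarithmic derivative of the radial
factor, times `r`. -/
lemma supersolution_algebra {n r w ε η Q δ F F' : ℝ} (hn : 1 ≤ n) (hr : 0 < r) (hw : 0 < w)
    (hwr : w ≤ 2 * r) (hε : 0 < ε) (hη0 : 0 ≤ η) (hη : η ≤ 1 / 4)
    (hδ : δ = 4 * n * (n + 4) * ε) (hδr : δ * r ≤ 1 / 4) (hF : F = w - n * ε * w ^ 2 / 2)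
    (hF' : F' = 1 - n * ε * w) (A : ℝ) (hA : A = n / 2 + η / 2 + δ * r) :
    0 < F ∧ -(n * ε) / F * (1 + 4 * ε * w) + F' / F * (2 * n * ε)
      - 2 * A / r ^ 2 * (F' / F) * (w + ε * r ^ 2)
      + (-((η ^ 2 + Q) / 4 + δ * r) + 2 * A - n * A + A ^ 2) / r ^ 2
      ≤ -(n ^ 2 / 4 + Q / 4) / r ^ 2 := by
  have hnε : 0 < n * ε := by positivity
  have hnw : n * ε * w ≤ 1 / 2 := by
    have h1 : n * ε * w ≤ n * ε * (2 * r) := by gcongr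
    have h2 : n * ε * r ≤ 4 * n * (n + 4) * ε * r / 20 := by
      have : 0 < n * ε * r := by positivity
      nlinarith
    rw [hδ] at hδr
    linarith
  have hFw : w / 2 ≤ F := by rw [hF]; nlinarith
  have hF0 : 0 < F := by linarith
  refine ⟨hF0, ?_⟩
  -- The claim multiplied by `r² F`. Three effects are separated: the curvature terms `b1`, the
  -- defect `F - wF'` of linearity `e1`, and the gain from `δ` in `e2`.
  have key : r ^ 2 * (-(n * ε) * (1 + 4 * ε * w) + F' * (2 * n * ε)) - 2 * A * F' * (w + ε * r ^ 2)
      + F * (-((η ^ 2 + Q) / 4 + δ * r) + 2 * A - n * A + A ^ 2) ≤ -(n ^ 2 / 4 + Q / 4) * F := by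
    have hF'0 : 0 ≤ F' := by rw [hF']; linarith
    have hF'1 : F' ≤ 1 := by rw [hF']; nlinarith
    have hA1 : n ≤ 2 * A := by
      have : 0 < δ * r := by rw [hδ]; positivity
      linarith
    have hA2 : A ≤ n / 2 + 2 := by linarith
    have e1 : F - w * F' = n * ε * w ^ 2 / 2 := by rw [hF, hF']; ring
    have e2 : -((η ^ 2 + Q) / 4 + δ * r) + 2 * A - n * A + A ^ 2 + n ^ 2 / 4 + Q / 4
        = 2 * A - δ * r * (1 - η - δ * r) := by rw [hA]; ring
    -- Because `2A ≥ n`, the cross term removes half of `2nεF'`; what is left is at most `nε(F' -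
    -- 1)r² ≤ 0`. The `-nε` comes from `F''`, which is why `F` has a quadratic correction.
    have b1 : r ^ 2 * (-(n * ε) * (1 + 4 * ε * w) + F' * (2 * n * ε)) - 2 * A * F' * (ε * r ^ 2)
        ≤ 0 := by
      have c1 : n * (F' * ε * r ^ 2) ≤ 2 * A * (F' * ε * r ^ 2) := by gcongr
      have c2 : n * ε * r ^ 2 * F' ≤ n * ε * r ^ 2 * 1 := by gcongr
      have c3 : 0 ≤ r ^ 2 * (n * ε * (4 * ε * w)) := by positivity
      nlinarith
    -- This fixes `δ`: with `A ≤ n/2 + 2`, `w ≤ 2r`, `F ≥ w/2` and `1 - η - δr ≥ 1/2`, both sides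
    -- meet at `n(n + 4)εwr` precisely when `δ = 4n(n + 4)ε`.
    have b2 : A * n * ε * w ^ 2 ≤ F * (δ * r * (1 - η - δ * r)) := by
      have c1 : A * n * ε * w ^ 2 ≤ (n / 2 + 2) * n * ε * (w * (2 * r)) := by
        rw [pow_two]; gcongr
      have c2 : w / 2 * (δ * r * (1 / 2)) ≤ F * (δ * r * (1 - η - δ * r)) := by
        have : 0 < δ * r := by rw [hδ]; positivity
        gcongr
        linarith
      refine c1.trans (le_trans (le_of_eq ?_) c2)
      rw [hδ]; ring
    have e3 : r ^ 2 * (-(n * ε) * (1 + 4 * ε * w) + F' * (2 * n * ε))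
        - 2 * A * F' * (w + ε * r ^ 2)
        + F * (-((η ^ 2 + Q) / 4 + δ * r) + 2 * A - n * A + A ^ 2) + (n ^ 2 / 4 + Q / 4) * F
        = (r ^ 2 * (-(n * ε) * (1 + 4 * ε * w) + F' * (2 * n * ε)) - 2 * A * F' * (ε * r ^ 2))
          + 2 * A * (F - w * F') - F * (δ * r * (1 - η - δ * r)) := by
      linear_combination F * e2
    rw [e1] at e3
    linarith
  rw [le_div_iff₀ (by positivity)]
  have := div_le_div_of_nonneg_right key hF0.le
  rw [mul_div_cancel_right₀ _ hF0.ne'] at this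
  refine le_trans (le_of_eq ?_) this
  field_simp

/-- The radial coefficient of the vector field. -/
noncomputable def radialCoeff (n : ℕ) (m : ℕ) (L δ r : ℝ) : ℝ :=
  -(n / 2 + sumX m (r / L) / 2 + δ * r) / r ^ 2

lemma hasDerivAt_radialCoeff (n m : ℕ) {L δ r : ℝ} (hr : 0 < r) (hL : r < L) :
    HasDerivAt (radialCoeff n m L δ)
      ((-((sumX m (r / L) ^ 2 + sumSqX m (r / L)) / 4 + δ * r)
        + 2 * (n / 2 + sumX m (r / L) / 2 + δ * r)) / r ^ 3) r := by
  have hL0 : 0 < L := hr.trans hL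
  have h1 := (hasDerivAt_sumX m (div_pos hr hL0) ((div_lt_one hL0).2 hL)).comp r
    ((hasDerivAt_id r).div_const L)
  have h2 := (((h1.div_const 2).const_add (n / 2 : ℝ)).add ((hasDerivAt_id r).const_mul δ)).neg.div
    (hasDerivAt_pow 2 r) (by positivity)
  refine (h2.congr_of_eventuallyEq (.of_forall fun s => ?_)).congr_deriv ?_
  · simp [radialCoeff]
  · simp
    field_simp
    ring

lemma contDiffAt_radialCoeff (n m : ℕ) {L δ r : ℝ} (hr : 0 < r) (hL : r < L) :
    ContDiffAt ℝ 1 (radialCoeff n m L δ) r := by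
  have hL0 : 0 < L := hr.trans hL
  have h1 : ContDiffAt ℝ 1 (fun r => sumX m (r / L)) r :=
    ContDiffAt.comp (g := sumX m) r
      ((contDiffAt_sumX m (div_pos hr hL0) ((div_lt_one hL0).2 hL)).of_le (by simp))
      (contDiffAt_id.div_const L)
  exact (((contDiffAt_const.add (h1.div_const 2)).add
    (contDiffAt_const.mul contDiffAt_id)).neg).div (contDiffAt_id.pow 2) (by simp; positivity)

/-- The defining function of the exterior ball of radius `1 / (2 ε)`. -/
noncomputable def ballFun (ε : ℝ) (ν x : EuclideanSpace ℝ (Fin n)) : ℝ :=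
  inner ℝ ν x + ε * ‖x‖ ^ 2

lemma hasFDerivAt_ballFun (ε : ℝ) (ν x : EuclideanSpace ℝ (Fin n)) :
    HasFDerivAt (ballFun ε ν) (innerSL ℝ ν + ε • (2 • innerSL ℝ x)) x :=
  (hasFDerivAt_inner ν x).add ((hasStrictFDerivAt_norm_sq x).hasFDerivAt.const_mul ε)

lemma contDiff_ballFun (ε : ℝ) (ν : EuclideanSpace ℝ (Fin n)) : ContDiff ℝ 1 (ballFun ε ν) :=
  (innerSL ℝ ν).contDiff.add (contDiff_const.mul (contDiff_norm_sq ℝ))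

/-- Here `α ν + β x = ∇ log φ`: `α = F'/F` multiplies `∇w = ν + 2εx`, which explains the summand
`2εα` of `β`, and `radialCoeff` is the contribution of the radial factor. The terms `±α²` cancel
between divergence and square, reducing the claim to `supersolution_algebra`. -/
lemma vectorField_bound {ν x : EuclideanSpace ℝ (Fin n)} {m : ℕ} {L ε δ : ℝ} (hn : 1 ≤ n)
    (hν : ‖ν‖ = 1) (hx : 0 < ‖x‖) (hxL : ‖x‖ < L) (hw : 0 < ballFun ε ν x) (hε : 0 < ε)
    (hη : sumX m (‖x‖ / L) ≤ 1 / 4) (hδ : δ = 4 * n * (n + 4) * ε) (hδr : δ * ‖x‖ ≤ 1 / 4) :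
    let α : EuclideanSpace ℝ (Fin n) → ℝ := fun y =>
      (1 - n * ε * ballFun ε ν y) / (ballFun ε ν y - n * ε * ballFun ε ν y ^ 2 / 2)
    let β : EuclideanSpace ℝ (Fin n) → ℝ := fun y => 2 * ε * α y + radialCoeff n m L δ ‖y‖
    ContDiffAt ℝ 1 α x ∧ ContDiffAt ℝ 1 β x ∧
      (n ^ 2 / 4 + sumSqX m (‖x‖ / L) / 4) / ‖x‖ ^ 2
        ≤ -(fderiv ℝ α x ν + fderiv ℝ β x x + n * β x + ‖α x • ν + β x • x‖ ^ 2) := by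
  intro α β
  have hx0 : x ≠ 0 := norm_pos_iff.1 hx
  have hn' : (1 : ℝ) ≤ n := by exact_mod_cast hn
  have hL0 : 0 < L := hx.trans hxL
  have hin : inner ℝ ν x ≤ ‖x‖ := by simpa [hν] using real_inner_le_norm ν x
  have hwr : ballFun ε ν x ≤ 2 * ‖x‖ := by
    have : ε * ‖x‖ ≤ 1 := by
      have h1 : ε * ‖x‖ ≤ δ * ‖x‖ := by
        gcongr
        rw [hδ]
        have : 1 ≤ 4 * (n : ℝ) * (n + 4) := by nlinarith
        nlinarith
      linarith
    unfold ballFun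
    nlinarith
  obtain ⟨hF, hmain⟩ := supersolution_algebra (Q := sumSqX m (‖x‖ / L)) hn' hx hw hwr hε
    (sumX_nonneg m (div_pos hx hL0) ((div_le_one hL0).2 hxL.le)) hη hδ hδr rfl rfl _ rfl
  have hwd := hasFDerivAt_ballFun ε ν x
  have hwc : ContDiffAt ℝ 1 (ballFun ε ν) x := (contDiff_ballFun ε ν).contDiffAt
  have hαc : ContDiffAt ℝ 1 α x :=
    (contDiffAt_const.sub (contDiffAt_const.mul hwc)).div
      (hwc.sub ((contDiffAt_const.mul (hwc.pow 2)).div_const 2)) hF.ne'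
  have hqc : ContDiffAt ℝ 1 (fun y : EuclideanSpace ℝ (Fin n) => radialCoeff n m L δ ‖y‖) x :=
    (contDiffAt_radialCoeff n m hx hxL).comp x (contDiffAt_norm ℝ hx0)
  have hβc : ContDiffAt ℝ 1 β x := (contDiffAt_const.mul hαc).add hqc
  refine ⟨hαc, hβc, ?_⟩
  set w := ballFun ε ν x with hwdef
  set F := w - n * ε * w ^ 2 / 2 with hFdef
  have had : HasDerivAt (fun s : ℝ => (1 - n * ε * s) / (s - n * ε * s ^ 2 / 2))
      (-(n * ε) / F - ((1 - n * ε * w) / F) ^ 2) w := by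
    have h1 := ((hasDerivAt_id w).const_mul (n * ε : ℝ)).const_sub 1
    have h2 := (hasDerivAt_id w).sub (((hasDerivAt_pow 2 w).const_mul (n * ε : ℝ)).div_const 2)
    refine (h1.div h2 hF.ne').congr_deriv ?_
    simp only [id, mul_one, Nat.cast_ofNat, Nat.add_one_sub_one, pow_one, Pi.sub_apply]
    rw [← hFdef]
    field_simp
  have hαd : HasFDerivAt α ((-(n * ε) / F - ((1 - n * ε * w) / F) ^ 2) •
      (innerSL ℝ ν + ε • (2 • innerSL ℝ x))) x := by
    have := HasDerivAt.comp_hasFDerivAt (f := ballFun ε ν) x had hwd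
    exact this
  have hqd := (hasDerivAt_radialCoeff n m (δ := δ) hx hxL).comp_hasFDerivAt x (hasFDerivAt_norm hx0)
  have hβd := (hαd.const_mul (2 * ε)).add hqd
  have e1 : fderiv ℝ α x ν = (-(n * ε) / F - ((1 - n * ε * w) / F) ^ 2) *
      (1 + 2 * ε * inner ℝ ν x) := by
    rw [hαd.fderiv]
    simp [hν, real_inner_comm]
    ring
  have e2 : fderiv ℝ β x x = 2 * ε * ((-(n * ε) / F - ((1 - n * ε * w) / F) ^ 2) *
      (inner ℝ ν x + 2 * ε * ‖x‖ ^ 2)) + (-((sumX m (‖x‖ / L) ^ 2 + sumSqX m (‖x‖ / L)) / 4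
        + δ * ‖x‖) + 2 * (n / 2 + sumX m (‖x‖ / L) / 2 + δ * ‖x‖)) / ‖x‖ ^ 2 := by
    refine (congrArg (fun A => A x) hβd.fderiv).trans ?_
    simp
    field_simp
  have e3 : ‖α x • ν + β x • x‖ ^ 2 = α x ^ 2 + 2 * α x * β x * inner ℝ ν x
      + β x ^ 2 * ‖x‖ ^ 2 := by
    rw [norm_add_sq_real, norm_smul, norm_smul, inner_smul_left, inner_smul_right, mul_pow,
      mul_pow, hν, Real.norm_eq_abs, Real.norm_eq_abs, sq_abs, sq_abs]
    simp
    ring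
  have hαx : α x = (1 - n * ε * w) / F := rfl
  have hβx : β x = 2 * ε * ((1 - n * ε * w) / F) + radialCoeff n m L δ ‖x‖ := rfl
  have hi : inner ℝ ν x = w - ε * ‖x‖ ^ 2 := by rw [hwdef, ballFun]; ring
  rw [e1, e2, e3, hαx, hβx, hi, radialCoeff, le_neg]
  refine (le_of_eq ?_).trans (hmain.trans (le_of_eq (neg_div _ _)))
  generalize sumX m (‖x‖ / L) = η
  generalize sumSqX m (‖x‖ / L) = Q
  generalize ‖x‖ = r at *
  clear_value F w
  field_simp
  ring

/-! ### Geometry of the domain and integrability of the Hardy terms -/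

lemma zero_notMem_of_mem_frontier {Ω : Set (EuclideanSpace ℝ (Fin n))} (hΩ : IsOpen Ω)
    (h0 : 0 ∈ frontier Ω) : (0 : EuclideanSpace ℝ (Fin n)) ∉ Ω := by
  rw [hΩ.frontier_eq] at h0
  exact h0.2

lemma norm_le_supNorm {Ω : Set (EuclideanSpace ℝ (Fin n))} (hΩ : Bornology.IsBounded Ω)
    {x : EuclideanSpace ℝ (Fin n)} (hx : x ∈ Ω) : ‖x‖ ≤ supNorm Ω := by
  obtain ⟨C, hC⟩ := hΩ.exists_norm_le
  exact le_csSup ⟨C, by rintro _ ⟨y, hy, rfl⟩; exact hC y hy⟩ ⟨x, hx, rfl⟩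

lemma supNorm_pos {Ω : Set (EuclideanSpace ℝ (Fin n))} (hΩ : IsBoundedDomain Ω)
    (h0 : 0 ∈ frontier Ω) : 0 < supNorm Ω := by
  obtain ⟨x, hx⟩ := hΩ.2.1.nonempty
  have hx0 : x ≠ 0 := fun h => zero_notMem_of_mem_frontier hΩ.1 h0 (h ▸ hx)
  exact (norm_pos_iff.2 hx0).trans_le (norm_le_supNorm hΩ.2.2 hx)

lemma ballFun_pos {Ω : Set (EuclideanSpace ℝ (Fin n))} (hΩ : IsOpen Ω) {ρ : ℝ} (hρ : 0 < ρ)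
    {ν : EuclideanSpace ℝ (Fin n)} (hν : ‖ν‖ = 1)
    (hball : Metric.ball (-(ρ • ν)) ρ ⊆ (closure Ω)ᶜ) {x : EuclideanSpace ℝ (Fin n)}
    (hx : x ∈ Ω) : 0 < ballFun (1 / (2 * ρ)) ν x := by
  by_contra hneg
  have hmem : x ∈ Metric.closedBall (-(ρ • ν)) ρ := by
    rw [Metric.mem_closedBall, dist_eq_norm, sub_neg_eq_add]
    refine le_of_sq_le_sq ?_ hρ.le
    rw [norm_add_sq_real, inner_smul_right, norm_smul, hν, Real.norm_of_nonneg hρ.le,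
      real_inner_comm]
    rw [ballFun, not_lt] at hneg
    have := mul_nonpos_of_nonneg_of_nonpos (by positivity : 0 ≤ 2 * ρ) hneg
    have e : 2 * ρ * (inner ℝ ν x + 1 / (2 * ρ) * ‖x‖ ^ 2) = 2 * ρ * inner ℝ ν x + ‖x‖ ^ 2 := by
      field_simp
    rw [e] at this
    linarith
  -- Points on the sphere itself must be excluded too: as `Ω` is open, a point of `Ω` in the closed
  -- ball would force `Ω` to meet the open ball.
  rw [← closure_ball _ hρ.ne', mem_closure_iff] at hmem
  obtain ⟨y, hyΩ, hyb⟩ := hmem Ω hΩ hx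
  exact hball hyb (subset_closure hyΩ)

lemma continuous_mul_of_tsupport_subset {E : Type*} [TopologicalSpace E] {u g : E → ℝ} {Ω : Set E}
    (hu : Continuous u) (hsub : tsupport u ⊆ Ω) (hg : ∀ x ∈ Ω, ContinuousAt g x) :
    Continuous fun x => u x * g x :=
  continuous_of_tsupport fun x hx =>
    hu.continuousAt.mul (hg x (hsub (tsupport_mul_subset_left hx)))

/-- With `u` factored out on the left, support arguments dispose of the singularity at the origin.
-/
lemma logHardy_integrand_eq (L : ℝ) (i : ℕ) (u : EuclideanSpace ℝ (Fin n) → ℝ)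
    (x : EuclideanSpace ℝ (Fin n)) :
    u x ^ 2 / ‖x‖ ^ 2 * ∏ j ∈ Finset.Icc 1 i, X j (‖x‖ / L) ^ 2
      = u x * (u x * (prodX i (‖x‖ / L) ^ 2 / ‖x‖ ^ 2)) := by
  rw [Finset.prod_pow, ← prodX]
  ring

lemma hardy_eq_logHardy (Ω : Set (EuclideanSpace ℝ (Fin n))) (L : ℝ)
    (u : EuclideanSpace ℝ (Fin n) → ℝ) : hardy Ω u = logHardy Ω L 0 u := by
  simp [hardy, logHardy]

lemma continuous_logHardy_integrand {Ω : Set (EuclideanSpace ℝ (Fin n))} {L : ℝ}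
    (hΩ : ∀ x ∈ Ω, 0 < ‖x‖ ∧ ‖x‖ < L) (i : ℕ) {u : EuclideanSpace ℝ (Fin n) → ℝ}
    (hu : Continuous u) (hut : tsupport u ⊆ Ω) :
    Continuous fun x => u x ^ 2 / ‖x‖ ^ 2 * ∏ j ∈ Finset.Icc 1 i, X j (‖x‖ / L) ^ 2 := by
  simp_rw [logHardy_integrand_eq]
  refine continuous_mul_of_tsupport_subset hu hut fun x hx => hu.continuousAt.mul ?_
  obtain ⟨hx0, hxL⟩ := hΩ x hx
  have hL0 := hx0.trans hxL
  have h1 : ContinuousAt (fun y : EuclideanSpace ℝ (Fin n) => prodX i (‖y‖ / L)) x :=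
    ContinuousAt.comp (g := prodX i)
      (contDiffAt_prodX i (div_pos hx0 hL0) ((div_lt_one hL0).2 hxL)).continuousAt
      (by fun_prop)
  exact (h1.pow 2).div (by fun_prop) (by positivity)

lemma integrable_logHardy {Ω : Set (EuclideanSpace ℝ (Fin n))} {L : ℝ}
    (hΩ : ∀ x ∈ Ω, 0 < ‖x‖ ∧ ‖x‖ < L) (i : ℕ) {u : EuclideanSpace ℝ (Fin n) → ℝ}
    (hu : IsTestFunction Ω u) :
    Integrable fun x => u x ^ 2 / ‖x‖ ^ 2 * ∏ j ∈ Finset.Icc 1 i, X j (‖x‖ / L) ^ 2 := by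
  refine (continuous_logHardy_integrand hΩ i hu.1.continuous
    hu.2.2).integrable_of_hasCompactSupport ?_
  simp_rw [logHardy_integrand_eq]
  exact hu.2.1.mul_right

lemma logHardy_nonneg (Ω : Set (EuclideanSpace ℝ (Fin n))) (L : ℝ) (i : ℕ)
    (u : EuclideanSpace ℝ (Fin n) → ℝ) : 0 ≤ logHardy Ω L i u := by
  refine integral_nonneg fun x => ?_
  simp only [Pi.zero_apply]
  positivity

lemma logHardy_eq_integral {Ω : Set (EuclideanSpace ℝ (Fin n))} (L : ℝ) (i : ℕ)
    {u : EuclideanSpace ℝ (Fin n) → ℝ} (hu : tsupport u ⊆ Ω) :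
    logHardy Ω L i u
      = ∫ x, u x ^ 2 / ‖x‖ ^ 2 * ∏ j ∈ Finset.Icc 1 i, X j (‖x‖ / L) ^ 2 := by
  refine setIntegral_eq_integral_of_forall_compl_eq_zero fun x hx => ?_
  simp [image_eq_zero_of_notMem_tsupport fun h => hx (hu h)]

lemma dirichlet_eq_integral {Ω : Set (EuclideanSpace ℝ (Fin n))}
    {u : EuclideanSpace ℝ (Fin n) → ℝ} (hu : tsupport u ⊆ Ω) :
    dirichlet Ω u = ∫ x, ‖gradient u x‖ ^ 2 := by
  refine setIntegral_eq_integral_of_forall_compl_eq_zero fun x hx => ?_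
  simp [norm_gradient, fderiv_of_notMem_tsupport ℝ fun h => hx (hu h)]

lemma logHardy_pos {Ω : Set (EuclideanSpace ℝ (Fin n))} {L : ℝ}
    (hΩ : ∀ x ∈ Ω, 0 < ‖x‖ ∧ ‖x‖ < L) (i : ℕ) {u : EuclideanSpace ℝ (Fin n) → ℝ}
    (hu : IsTestFunction Ω u) (hne : u ≠ 0) : 0 < logHardy Ω L i u := by
  rw [logHardy_eq_integral L i hu.2.2]
  obtain ⟨x, hx⟩ := Function.ne_iff.1 hne
  refine (continuous_logHardy_integrand hΩ i hu.1.continuous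
    hu.2.2).integral_pos_of_hasCompactSupport_nonneg_nonzero (x := x) ?_ (fun y => ?_) ?_
  · simp_rw [logHardy_integrand_eq]
    exact hu.2.1.mul_right
  · simp only [Pi.zero_apply]; positivity
  · obtain ⟨hx0, hxL⟩ := hΩ x (hu.2.2 (subset_tsupport _ hx))
    have hL0 := hx0.trans hxL
    have hpos : ∀ j, 0 < X j (‖x‖ / L) := fun j =>
      X_pos j (div_pos hx0 hL0) ((div_le_one hL0).2 hxL.le)
    refine mul_ne_zero (div_ne_zero (pow_ne_zero _ hx) (by positivity)) ?_
    exact Finset.prod_ne_zero_iff.2 fun j _ => pow_ne_zero _ (hpos j).ne'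

lemma norm_mem_of_isKappa {κ : ℝ} (hκ : IsKappa κ) {Ω : Set (EuclideanSpace ℝ (Fin n))}
    (hΩ : IsBoundedDomain Ω) (h0 : 0 ∈ frontier Ω) {x : EuclideanSpace ℝ (Fin n)} (hx : x ∈ Ω) :
    0 < ‖x‖ ∧ ‖x‖ < 3 * κ * supNorm Ω := by
  have hx0 : x ≠ 0 := fun h => zero_notMem_of_mem_frontier hΩ.1 h0 (h ▸ hx)
  refine ⟨norm_pos_iff.2 hx0, (norm_le_supNorm hΩ.2.2 hx).trans_lt ?_⟩
  have := hκ.1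
  have := supNorm_pos hΩ h0
  nlinarith

/-- The condition on `ρ` does not involve `m`; this uniformity is what allows the passage to the
full series. -/
theorem hardy_add_sum_logHardy_le {κ : ℝ} (hκ : IsKappa κ) (hn : 1 ≤ n)
    {Ω : Set (EuclideanSpace ℝ (Fin n))} (hΩ : IsBoundedDomain Ω) (h0 : 0 ∈ frontier Ω) {ρ : ℝ}
    (hρ : HasExteriorBall Ω ρ) (hσ : supNorm Ω / (1 / (8 * n * (n + 4))) ≤ ρ)
    {u : EuclideanSpace ℝ (Fin n) → ℝ} (hu : IsTestFunction Ω u) (m : ℕ) :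
    (n : ℝ) ^ 2 / 4 * hardy Ω u
      + 1 / 4 * ∑ i ∈ Finset.Icc 1 m, logHardy Ω (3 * κ * supNorm Ω) i u ≤ dirichlet Ω u := by
  obtain ⟨hρ0, ν, hν, hball⟩ := hρ
  have hκ0 : 0 < κ := one_pos.trans hκ.1
  have hD := supNorm_pos hΩ h0
  set L := 3 * κ * supNorm Ω with hL
  have hL0 : 0 < L := by positivity
  have hnorm : ∀ x ∈ Ω, 0 < ‖x‖ ∧ ‖x‖ < L := fun x hx => norm_mem_of_isKappa hκ hΩ h0 hx
  have hint := fun i => integrable_logHardy hnorm i hu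
  set V : EuclideanSpace ℝ (Fin n) → ℝ := fun x =>
    (n ^ 2 / 4 + sumSqX m (‖x‖ / L) / 4) / ‖x‖ ^ 2 with hV
  have hVu : (fun x => V x * u x ^ 2) = fun x =>
      n ^ 2 / 4 * (u x ^ 2 / ‖x‖ ^ 2 * ∏ j ∈ Finset.Icc 1 0, X j (‖x‖ / L) ^ 2) + 1 / 4 *
        ∑ i ∈ Finset.Icc 1 m, u x ^ 2 / ‖x‖ ^ 2 * ∏ j ∈ Finset.Icc 1 i, X j (‖x‖ / L) ^ 2 := by
    ext x
    rw [← Finset.mul_sum]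
    have hp : ∀ i, ∏ j ∈ Finset.Icc 1 i, X j (‖x‖ / L) ^ 2 = prodX i (‖x‖ / L) ^ 2 :=
      fun i => Finset.prod_pow _ _ _
    simp_rw [hp]
    rw [← sumSqX]
    simp only [hV, prodX_zero]
    ring
  have hi1 : IntegrableOn (fun x => (n : ℝ) ^ 2 / 4 *
      (u x ^ 2 / ‖x‖ ^ 2 * ∏ j ∈ Finset.Icc 1 0, X j (‖x‖ / L) ^ 2)) Ω :=
    ((hint 0).const_mul _).integrableOn
  have hi2 : IntegrableOn (fun x => (1 / 4 : ℝ) * ∑ i ∈ Finset.Icc 1 m,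
      u x ^ 2 / ‖x‖ ^ 2 * ∏ j ∈ Finset.Icc 1 i, X j (‖x‖ / L) ^ 2) Ω :=
    ((integrable_finsetSum _ fun i _ => hint i).const_mul _).integrableOn
  have hVint : IntegrableOn (fun x => V x * u x ^ 2) Ω := by
    rw [hVu]
    exact hi1.add hi2
  -- `ε = 1/(2ρ)` makes `w` the defining function of the exterior ball. The scale `L = 3κD` keeps
  -- `|x|/L` below `1/κ`, hence `η ≤ 1/4`, and `ρ ≥ 8n(n + 4)D` gives `δ|x| = 2n(n + 4)|x|/ρ ≤ 1/4`.
  have hpt : ∀ x ∈ Ω, _ := fun x hx =>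
    vectorField_bound (m := m) (L := L) (ε := 1 / (2 * ρ)) (δ := 4 * n * (n + 4) * (1 / (2 * ρ)))
      hn hν (hnorm x hx).1 (hnorm x hx).2 (ballFun_pos hΩ.1 hρ0 hν hball hx) (by positivity)
      (hκ.sumX_le m (div_pos (hnorm x hx).1 hL0) (by
        rw [div_le_div_iff₀ hL0 hκ0, hL]
        have := mul_le_mul_of_nonneg_right (norm_le_supNorm hΩ.2.2 hx) hκ0.le
        have : 0 < supNorm Ω * κ := by positivity
        nlinarith)) rfl (by
        have h1 := norm_le_supNorm hΩ.2.2 hx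
        rw [div_div_eq_mul_div, div_one] at hσ
        have : ‖x‖ * (8 * n * (n + 4)) ≤ ρ := le_trans (by gcongr) hσ
        rw [mul_one_div, div_mul_eq_mul_div, div_le_div_iff₀ (by positivity) (by positivity)]
        nlinarith)
  have := integral_mul_sq_le_dirichlet hΩ.1.measurableSet hu ν (fun x hx => (hpt x hx).1)
    (fun x hx => (hpt x hx).2.1) hVint fun x hx => (hpt x hx).2.2
  refine le_trans (le_of_eq ?_) this
  rw [hVu, integral_add hi1 hi2, integral_const_mul, integral_const_mul, integral_finsetSum]
  · rw [hardy_eq_logHardy Ω L]; rfl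
  · exact fun i _ => (hint i).integrableOn

theorem summable_logHardy_and_le {κ : ℝ} (hκ : IsKappa κ) (hn : 1 ≤ n)
    {Ω : Set (EuclideanSpace ℝ (Fin n))} (hΩ : IsBoundedDomain Ω) (h0 : 0 ∈ frontier Ω) {ρ : ℝ}
    (hρ : HasExteriorBall Ω ρ) (hσ : supNorm Ω / (1 / (8 * n * (n + 4))) ≤ ρ)
    {u : EuclideanSpace ℝ (Fin n) → ℝ} (hu : IsTestFunction Ω u) :
    Summable (fun i : ℕ => logHardy Ω (3 * κ * supNorm Ω) (i + 1) u) ∧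
      (n : ℝ) ^ 2 / 4 * hardy Ω u
        + 1 / 4 * ∑' i : ℕ, logHardy Ω (3 * κ * supNorm Ω) (i + 1) u ≤ dirichlet Ω u := by
  have key : ∀ m : ℕ, ∑ i ∈ Finset.range m, logHardy Ω (3 * κ * supNorm Ω) (i + 1) u
      ≤ 4 * (dirichlet Ω u - (n : ℝ) ^ 2 / 4 * hardy Ω u) := by
    intro m
    have h := hardy_add_sum_logHardy_le hκ hn hΩ h0 hρ hσ hu m
    have e : ∑ i ∈ Finset.range m, logHardy Ω (3 * κ * supNorm Ω) (i + 1) u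
        = ∑ i ∈ Finset.Icc 1 m, logHardy Ω (3 * κ * supNorm Ω) i u := by
      rw [Finset.range_eq_Ico, Finset.sum_Ico_add' (fun i => logHardy Ω (3 * κ * supNorm Ω) i u)]
      rfl
    rw [e]
    linarith
  have hs := summable_of_sum_range_le (fun i => logHardy_nonneg _ _ _ _) key
  refine ⟨hs, ?_⟩
  have := Real.tsum_le_of_sum_range_le (fun i => logHardy_nonneg _ _ _ _) key
  linarith

/-! ### Polar coordinates for functions of the radius and one angle -/

/-- The cosine of the angle between `e` and `x`, for a unit vector `e`. -/
noncomputable def cosAngle (e x : EuclideanSpace ℝ (Fin n)) : ℝ := inner ℝ e x / ‖x‖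

/-- The integral of `k(⟨e, θ⟩)` over the unit sphere. -/
noncomputable def sphereInt (e : EuclideanSpace ℝ (Fin n)) (k : ℝ → ℝ) : ℝ :=
  ∫ θ : Metric.sphere (0 : EuclideanSpace ℝ (Fin n)) 1, k (inner ℝ e θ) ∂(volume.toSphere)

/-- Polar coordinates: the origin is null, and on its complement the integrand is a product of a
function on the sphere and a function of the radius. -/
lemma integral_cosAngle_mul_norm (hn : 1 ≤ n) (e : EuclideanSpace ℝ (Fin n)) (k H : ℝ → ℝ) :
    ∫ x, k (cosAngle e x) * H ‖x‖ = sphereInt e k * ∫ r in Ioi (0 : ℝ), r ^ (n - 1) * H r := by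
  have : Nonempty (Fin n) := ⟨⟨0, hn⟩⟩
  have hdim : Module.finrank ℝ (EuclideanSpace ℝ (Fin n)) = n := by simp
  let μ : Measure (EuclideanSpace ℝ (Fin n)) := volume
  calc ∫ x, k (cosAngle e x) * H ‖x‖
      = ∫ x : ({(0)}ᶜ : Set (EuclideanSpace ℝ (Fin n))), k (cosAngle e x) * H ‖x.1‖
          ∂(μ.comap (↑)) := by
        rw [integral_subtype_comap (measurableSet_singleton _).compl
          fun x => k (cosAngle e x) * H ‖x‖, restrict_compl_singleton]
    _ = ∫ p : Metric.sphere (0 : EuclideanSpace ℝ (Fin n)) 1 × Ioi (0 : ℝ),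
          k (inner ℝ e (p.1 : EuclideanSpace ℝ (Fin n))) * H p.2
          ∂(μ.toSphere.prod (.volumeIoiPow (n - 1))) := by
        have h := μ.measurePreserving_homeomorphUnitSphereProd.integral_comp
          (Homeomorph.measurableEmbedding _)
          (fun p : Metric.sphere (0 : EuclideanSpace ℝ (Fin n)) 1 × Ioi (0 : ℝ) =>
            k (inner ℝ e (p.1 : EuclideanSpace ℝ (Fin n))) * H p.2)
        rw [hdim] at h
        rw [← h]
        refine integral_congr_ae (.of_forall fun x => ?_)
        simp [cosAngle, inner_smul_right, div_eq_inv_mul]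
    _ = sphereInt e k * ∫ r : Ioi (0 : ℝ), H r ∂(Measure.volumeIoiPow (n - 1)) :=
        integral_prod_mul (fun θ : Metric.sphere (0 : EuclideanSpace ℝ (Fin n)) 1 =>
          k (inner ℝ e (θ : EuclideanSpace ℝ (Fin n)))) (fun r : Ioi (0 : ℝ) => H r)
    _ = _ := by
        congr 1
        simp only [Measure.volumeIoiPow, ENNReal.ofReal]
        rw [integral_withDensity_eq_integral_smul,
          integral_subtype_comap measurableSet_Ioi fun a ↦ Real.toNNReal (a ^ (n - 1)) • H a,
          setIntegral_congr_fun measurableSet_Ioi fun x hx ↦ ?_]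
        · simp only [NNReal.smul_def, Real.coe_toNNReal _ (pow_nonneg hx.out.le _), smul_eq_mul]
        · exact (measurable_subtype_coe.pow_const _).real_toNNReal

lemma integrable_sphere (e : EuclideanSpace ℝ (Fin n)) {k : ℝ → ℝ} (hk : Continuous k) :
    Integrable (fun θ : Metric.sphere (0 : EuclideanSpace ℝ (Fin n)) 1 => k (inner ℝ e (θ :
      EuclideanSpace ℝ (Fin n)))) (volume.toSphere) := by
  have hc : Continuous fun θ : Metric.sphere (0 : EuclideanSpace ℝ (Fin n)) 1 =>
      k (inner ℝ e (θ : EuclideanSpace ℝ (Fin n))) := by fun_prop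
  exact hc.integrable_of_hasCompactSupport (HasCompactSupport.of_compactSpace _)

lemma sphereInt_mono {e : EuclideanSpace ℝ (Fin n)} (he : ‖e‖ = 1) {k l : ℝ → ℝ}
    (hk : Continuous k) (hl : Continuous l) (h : ∀ s, s ≤ 1 → k s ≤ l s) :
    sphereInt e k ≤ sphereInt e l := by
  refine integral_mono (integrable_sphere e hk) (integrable_sphere e hl) fun θ => h _ ?_
  simpa [he] using real_inner_le_norm e (θ : EuclideanSpace ℝ (Fin n))

lemma sphereInt_sub (e : EuclideanSpace ℝ (Fin n)) {k l : ℝ → ℝ} (hk : Continuous k)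
    (hl : Continuous l) : sphereInt e (fun s => k s - l s) = sphereInt e k - sphereInt e l :=
  integral_sub (integrable_sphere e hk) (integrable_sphere e hl)

lemma sphereInt_add (e : EuclideanSpace ℝ (Fin n)) {k l : ℝ → ℝ} (hk : Continuous k)
    (hl : Continuous l) : sphereInt e (fun s => k s + l s) = sphereInt e k + sphereInt e l :=
  integral_add (integrable_sphere e hk) (integrable_sphere e hl)

lemma sphereInt_const_mul (e : EuclideanSpace ℝ (Fin n)) (c : ℝ) (k : ℝ → ℝ) :
    sphereInt e (fun s => c * k s) = c * sphereInt e k :=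
  integral_const_mul _ _

lemma sphereInt_nonneg (e : EuclideanSpace ℝ (Fin n)) {k : ℝ → ℝ} (h : ∀ s, 0 ≤ k s) :
    0 ≤ sphereInt e k := integral_nonneg fun _ => h _

lemma hasFDerivAt_cosAngle (e : EuclideanSpace ℝ (Fin n)) {x : EuclideanSpace ℝ (Fin n)}
    (hx : x ≠ 0) : HasFDerivAt (cosAngle e)
      (‖x‖⁻¹ • innerSL ℝ e - (cosAngle e x / ‖x‖ ^ 2) • innerSL ℝ x) x := by
  have hx' : ‖x‖ ≠ 0 := norm_ne_zero_iff.2 hx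
  have h1 : HasFDerivAt (fun y : EuclideanSpace ℝ (Fin n) => ‖y‖⁻¹)
      ((-(‖x‖ ^ 2)⁻¹) • (‖x‖⁻¹ • innerSL ℝ x)) x :=
    HasDerivAt.comp_hasFDerivAt (f := fun y : EuclideanSpace ℝ (Fin n) => ‖y‖) x
      (hasDerivAt_inv hx') (hasFDerivAt_norm hx)
  refine ((hasFDerivAt_inner e x).fun_mul h1).congr_fderiv ?_
  ext y
  simp [cosAngle]
  field_simp
  ring

lemma contDiffAt_cosAngle (e : EuclideanSpace ℝ (Fin n)) {x : EuclideanSpace ℝ (Fin n)}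
    (hx : x ≠ 0) {k : ℕ∞ω} : ContDiffAt ℝ k (cosAngle e) x :=
  (innerSL ℝ e).contDiff.contDiffAt.div (contDiffAt_norm ℝ hx) (norm_ne_zero_iff.2 hx)

/-- A smooth radial bump supported in a shell. -/
noncomputable def shellBump : ContDiffBump (2 : ℝ) := ⟨1 / 2, 1, by norm_num, by norm_num⟩

/-- The bump `shellBump` evaluated at `‖x‖²`. -/
noncomputable def shell (x : EuclideanSpace ℝ (Fin n)) : ℝ := shellBump (‖x‖ ^ 2)

lemma contDiff_shell {k : ℕ∞} : ContDiff ℝ k (shell (n := n)) :=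
  shellBump.contDiff.comp (contDiff_norm_sq ℝ)

lemma shell_nonneg (x : EuclideanSpace ℝ (Fin n)) : 0 ≤ shell x := shellBump.nonneg

lemma tsupport_shell_subset : tsupport (shell (n := n)) ⊆ {x | 1 ≤ ‖x‖ ^ 2 ∧ ‖x‖ ^ 2 ≤ 3} := by
  have hcl : IsClosed {x : EuclideanSpace ℝ (Fin n) | 1 ≤ ‖x‖ ^ 2 ∧ ‖x‖ ^ 2 ≤ 3} :=
    isClosed_Icc.preimage (f := fun x : EuclideanSpace ℝ (Fin n) => ‖x‖ ^ 2) (t := Icc 1 3)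
      (by fun_prop)
  refine closure_minimal (fun x hx => ?_) hcl
  have : ‖x‖ ^ 2 ∈ Function.support shellBump := hx
  rw [shellBump.support_eq, Real.ball_eq_Ioo] at this
  have h1 : shellBump.rOut = 1 := rfl
  rw [h1] at this
  constructor <;> linarith [this.1, this.2]

lemma ne_zero_of_mem_tsupport_shell {x : EuclideanSpace ℝ (Fin n)} (hx : x ∈ tsupport shell) :
    x ≠ 0 := by
  rintro rfl
  have := (tsupport_shell_subset hx).1
  norm_num at this

lemma hasCompactSupport_shell : HasCompactSupport (shell (n := n)) := by
  refine HasCompactSupport.of_support_subset_isCompact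
    (isCompact_closedBall (0 : EuclideanSpace ℝ (Fin n)) 2) fun x hx => ?_
  have := (tsupport_shell_subset (subset_tsupport _ hx)).2
  rw [mem_closedBall_zero_iff]
  nlinarith [norm_nonneg x]

lemma hasFDerivAt_shell (x : EuclideanSpace ℝ (Fin n)) :
    ∃ c : ℝ, HasFDerivAt shell (c • innerSL ℝ x) x := by
  have h1 := (shellBump.contDiff (n := 1)).differentiable one_ne_zero (‖x‖ ^ 2)
  have h2 := h1.hasDerivAt.comp_hasFDerivAt (f := fun y => ‖y‖ ^ 2) x
    (hasStrictFDerivAt_norm_sq x).hasFDerivAt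
  refine ⟨deriv shellBump (‖x‖ ^ 2) * 2, h2.congr_fderiv ?_⟩
  ext y
  simp
  ring

lemma shell_sqrt_two_smul {e : EuclideanSpace ℝ (Fin n)} (he : ‖e‖ = 1) :
    shell (√2 • e) = 1 := by
  rw [shell, norm_smul, he, mul_one, Real.norm_of_nonneg (by positivity), Real.sq_sqrt (by simp)]
  exact shellBump.one_of_mem_closedBall (by simp [shellBump.rIn_pos.le])

/-- A nonnegative continuous angular profile that is positive at the pole has positive integral. -/
lemma sphereInt_pos (hn : 1 ≤ n) {e : EuclideanSpace ℝ (Fin n)} (he : ‖e‖ = 1) {k : ℝ → ℝ}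
    (hk : Continuous k) (h0 : ∀ s, 0 ≤ k s) (h1 : 0 < k 1) : 0 < sphereInt e k := by
  have hc : Continuous fun x => shell x * k (cosAngle e x) :=
    continuous_mul_of_tsupport_subset (Ω := {0}ᶜ) (contDiff_shell (k := 0)).continuous
      (fun x hx => ne_zero_of_mem_tsupport_shell hx)
      fun x hx => hk.continuousAt.comp (contDiffAt_cosAngle e hx (k := 0)).continuousAt
  have hcos : cosAngle e (√2 • e) = 1 := by
    have : √2 ≠ 0 := by positivity
    rw [cosAngle, norm_smul, inner_smul_right, real_inner_self_eq_norm_sq, he]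
    simp [abs_of_nonneg (Real.sqrt_nonneg 2), this]
  -- Positivity is easier for the volume integral, where a nonnegative continuous integrand is
  -- nonzero at `√2 • e`; polar coordinates then transfer it to the sphere.
  have hpos : 0 < ∫ x, shell x * k (cosAngle e x) :=
    hc.integral_pos_of_hasCompactSupport_nonneg_nonzero (x := √2 • e)
      hasCompactSupport_shell.mul_right
      (fun x => mul_nonneg (shell_nonneg x) (h0 _)) (by
        rw [shell_sqrt_two_smul he, hcos, one_mul]; exact h1.ne')
  have e1 : ∫ x, shell x * k (cosAngle e x)
      = sphereInt e k * ∫ r in Ioi (0 : ℝ), r ^ (n - 1) * shellBump (r ^ 2) := by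
    rw [← integral_cosAngle_mul_norm hn e k fun r => shellBump (r ^ 2)]
    exact integral_congr_ae (.of_forall fun x => mul_comm _ _)
  rw [e1] at hpos
  refine (sphereInt_nonneg e h0).lt_of_ne fun h => ?_
  rw [← h, zero_mul] at hpos
  exact hpos.false

/-- Integration by parts on the sphere for functions of one angle: `s` is an eigenfunction of the
spherical Laplacian with eigenvalue `n - 1`. -/
lemma sphereInt_deriv_mul (hn : 1 ≤ n) {e : EuclideanSpace ℝ (Fin n)} (he : ‖e‖ = 1)
    {ξ ξ' : ℝ → ℝ} (hξ : ∀ s, HasDerivAt ξ (ξ' s) s) (hξ' : Continuous ξ') :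
    sphereInt e (fun s => ξ' s * (1 - s ^ 2)) = (n - 1) * sphereInt e (fun s => s * ξ s) := by
  have hξc : ContDiff ℝ 1 ξ := contDiff_one_iff_deriv.2
    ⟨fun s => (hξ s).differentiableAt, by rw [funext fun s => (hξ s).deriv]; exact hξ'⟩
  -- With `s = cosAngle e x`, the field `g e + l x = (ξ(s)/r)(e - s x/r)` is tangent to the spheres,
  -- so a radial cutoff adds nothing to its divergence, which is `(ξ'(s)(1 - s²) - (n - 1) s
  -- ξ(s))/r²`.
  set g : EuclideanSpace ℝ (Fin n) → ℝ := fun x => ξ (cosAngle e x) * ‖x‖⁻¹ with hg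
  set l : EuclideanSpace ℝ (Fin n) → ℝ := fun x =>
    -(cosAngle e x * ξ (cosAngle e x)) * (‖x‖⁻¹ * ‖x‖⁻¹) with hl
  have hinv : ∀ x : EuclideanSpace ℝ (Fin n), x ≠ 0 →
      ContDiffAt ℝ 1 (fun y : EuclideanSpace ℝ (Fin n) => ‖y‖⁻¹) x := fun x hx =>
    (contDiffAt_norm ℝ hx).inv (norm_ne_zero_iff.2 hx)
  have hξs : ∀ x : EuclideanSpace ℝ (Fin n), x ≠ 0 →
      ContDiffAt ℝ 1 (fun y => ξ (cosAngle e y)) x := fun x hx =>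
    hξc.contDiffAt.comp x (contDiffAt_cosAngle e hx)
  have hgc : ∀ x ∈ ({0}ᶜ : Set (EuclideanSpace ℝ (Fin n))), ContDiffAt ℝ 1 g x := fun x hx =>
    (hξs x hx).mul (hinv x hx)
  have hlc : ∀ x ∈ ({0}ᶜ : Set (EuclideanSpace ℝ (Fin n))), ContDiffAt ℝ 1 l x := fun x hx =>
    (((contDiffAt_cosAngle e hx).mul (hξs x hx)).neg).mul ((hinv x hx).mul (hinv x hx))
  have hsub : tsupport (shell (n := n)) ⊆ {0}ᶜ := fun x hx => ne_zero_of_mem_tsupport_shell hx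
  have hp := contDiff_mul_of_tsupport_subset (contDiff_shell (k := 1)) hsub hgc
  have hq := contDiff_mul_of_tsupport_subset (contDiff_shell (k := 1)) hsub hlc
  have hpc : HasCompactSupport fun x => shell x * g x := hasCompactSupport_shell.mul_right
  have hqc : HasCompactSupport fun x => shell x * l x := hasCompactSupport_shell.mul_right
  have hpi : Integrable fun x => fderiv ℝ (fun x => shell x * g x) x e :=
    ((hp.continuous_fderiv one_ne_zero).clm_apply continuous_const).integrable_of_hasCompactSupport
      (hpc.fderiv_apply ℝ e)
  have hqi := integrable_fderiv_self_add hq hqc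
  have hzero : ∫ x, (fderiv ℝ (fun x => shell x * g x) x e
      + (fderiv ℝ (fun x => shell x * l x) x x + n * (shell x * l x))) = 0 := by
    rw [integral_add hpi hqi, integral_fderiv_apply_eq_zero hp hpc,
      integral_fderiv_self_add hq hqc, add_zero]
  set k : ℝ → ℝ := fun s => ξ' s * (1 - s ^ 2) - (n - 1) * (s * ξ s) with hk
  have hpt : ∀ x, fderiv ℝ (fun x => shell x * g x) x e
      + (fderiv ℝ (fun x => shell x * l x) x x + n * (shell x * l x))
      = k (cosAngle e x) * (shellBump (‖x‖ ^ 2) / ‖x‖ ^ 2) := by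
    intro x
    by_cases hx : x ∈ tsupport (shell (n := n))
    · have hx0 : x ≠ 0 := hsub hx
      have hr : ‖x‖ ≠ 0 := norm_ne_zero_iff.2 hx0
      obtain ⟨c, hc⟩ := hasFDerivAt_shell x
      have hs := hasFDerivAt_cosAngle e hx0
      have hξd : HasFDerivAt (fun y => ξ (cosAngle e y)) _ x :=
        HasDerivAt.comp_hasFDerivAt (f := cosAngle e) x (hξ _) hs
      have hid : HasFDerivAt (fun y : EuclideanSpace ℝ (Fin n) => ‖y‖⁻¹)
          ((-(‖x‖ ^ 2)⁻¹) • (‖x‖⁻¹ • innerSL ℝ x)) x :=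
        HasDerivAt.comp_hasFDerivAt (f := fun y : EuclideanSpace ℝ (Fin n) => ‖y‖) x
          (hasDerivAt_inv hr) (hasFDerivAt_norm hx0)
      have h1 := (hc.fun_mul (hξd.fun_mul hid)).fderiv
      have h2 := (hc.fun_mul ((hs.fun_mul hξd).fun_neg.fun_mul (hid.fun_mul hid))).fderiv
      have hin : inner ℝ e x = cosAngle e x * ‖x‖ := by rw [cosAngle]; field_simp
      have hin' : inner ℝ x e = cosAngle e x * ‖x‖ := by rw [real_inner_comm, hin]
      rw [hg, hl, h1, h2, hk]
      have hsh : shellBump (‖x‖ ^ 2) = shell x := rfl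
      rw [hsh]
      simp [hin, hin', he]
      generalize cosAngle e x = s
      field_simp
      ring
    · have h0 : shell x = 0 := image_eq_zero_of_notMem_tsupport hx
      have h1 : x ∉ tsupport fun x => shell x * g x := fun h => hx (tsupport_mul_subset_left h)
      have h2 : x ∉ tsupport fun x => shell x * l x := fun h => hx (tsupport_mul_subset_left h)
      have h3 : shellBump (‖x‖ ^ 2) = 0 := h0
      rw [fderiv_of_notMem_tsupport _ h1, fderiv_of_notMem_tsupport _ h2, h0, h3]
      simp
  rw [integral_congr_ae (.of_forall hpt),
    integral_cosAngle_mul_norm hn e k fun r => shellBump (r ^ 2) / r ^ 2] at hzero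
  -- The integral has factored into an angular and a radial part; the radial one is nonzero by
  -- comparison with the constant angular profile.
  have hne : ∫ r in Ioi (0 : ℝ), r ^ (n - 1) * (shellBump (r ^ 2) / r ^ 2) ≠ 0 := by
    intro h
    have h1 := integral_cosAngle_mul_norm hn e (fun _ => 1) fun r => shellBump (r ^ 2) / r ^ 2
    rw [h, mul_zero] at h1
    have hc : Continuous fun x : EuclideanSpace ℝ (Fin n) => shell x * (‖x‖ ^ 2)⁻¹ :=
      continuous_mul_of_tsupport_subset (contDiff_shell (k := 0)).continuous hsub fun x hx =>
        (by fun_prop : ContinuousAt (fun x : EuclideanSpace ℝ (Fin n) => ‖x‖ ^ 2) x).inv₀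
          (pow_ne_zero _ (norm_ne_zero_iff.2 hx))
    have hpos : 0 < ∫ x : EuclideanSpace ℝ (Fin n), shell x * (‖x‖ ^ 2)⁻¹ :=
      hc.integral_pos_of_hasCompactSupport_nonneg_nonzero (x := √2 • e)
        hasCompactSupport_shell.mul_right
        (fun x => mul_nonneg (shell_nonneg x) (by positivity)) (by
          rw [shell_sqrt_two_smul he, norm_smul, he]; simp)
    refine hpos.ne' (Eq.trans ?_ h1)
    exact integral_congr_ae (.of_forall fun x => by simp [shell, div_eq_mul_inv])
  have hk0 : sphereInt e k = 0 := (mul_eq_zero.1 hzero).resolve_right hne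
  have hξcont := hξc.continuous
  rw [hk, sphereInt_sub e (by fun_prop) (by fun_prop), sphereInt_const_mul] at hk0
  linarith

/-! ### The angular profile -/

/-- A smooth function that vanishes for `s ≤ a` and equals `1` for `s ≥ 2 a`. -/
noncomputable def angStep (a s : ℝ) : ℝ := Real.smoothTransition (s / a - 1)

/-- A smooth approximation of `max s 0` that vanishes for `s ≤ a`. -/
noncomputable def angProfile (a s : ℝ) : ℝ := ∫ τ in (0 : ℝ)..s, angStep a τ

lemma contDiff_angStep (a : ℝ) : ContDiff ℝ ∞ (angStep a) :=
  Real.smoothTransition.contDiff.comp ((contDiff_id.div_const a).sub contDiff_const)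

lemma angStep_nonneg (a s : ℝ) : 0 ≤ angStep a s := Real.smoothTransition.nonneg _

lemma angStep_le_one (a s : ℝ) : angStep a s ≤ 1 := Real.smoothTransition.le_one _

lemma angStep_eq_zero {a s : ℝ} (ha : 0 < a) (h : s ≤ a) : angStep a s = 0 :=
  Real.smoothTransition.zero_of_nonpos (by linarith [(div_le_one ha).2 h])

lemma angStep_eq_one {a s : ℝ} (ha : 0 < a) (h : 2 * a ≤ s) : angStep a s = 1 :=
  Real.smoothTransition.one_of_one_le (by linarith [(le_div_iff₀ ha).2 h])

lemma hasDerivAt_angProfile (a s : ℝ) : HasDerivAt (angProfile a) (angStep a s) s :=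
  intervalIntegral.integral_hasDerivAt_right
    ((contDiff_angStep a).continuous.intervalIntegrable _ _)
    (contDiff_angStep a).continuous.aestronglyMeasurable.stronglyMeasurableAtFilter
    (contDiff_angStep a).continuous.continuousAt

lemma contDiff_angProfile (a : ℝ) : ContDiff ℝ ∞ (angProfile a) := by
  rw [contDiff_infty_iff_deriv, funext fun s => (hasDerivAt_angProfile a s).deriv]
  exact ⟨fun s => (hasDerivAt_angProfile a s).differentiableAt, contDiff_angStep a⟩

lemma angProfile_eq_zero {a s : ℝ} (ha : 0 < a) (h : s ≤ a) : angProfile a s = 0 := by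
  refine intervalIntegral.integral_zero_ae (.of_forall fun τ hτ => angStep_eq_zero ha ?_)
  rcases le_total 0 s with hs | hs
  · rw [uIoc_of_le hs] at hτ; exact hτ.2.trans h
  · rw [uIoc_of_ge hs] at hτ; exact hτ.2.trans ha.le

lemma angProfile_ge {a s : ℝ} (ha : 0 < a) (h : 0 ≤ s) : s - 2 * a ≤ angProfile a s := by
  have hc := (contDiff_angStep a).continuous
  rcases le_total s (2 * a) with hs | hs
  · have : 0 ≤ angProfile a s := intervalIntegral.integral_nonneg h fun τ _ => angStep_nonneg a τ
    linarith
  · have e : angProfile a s = angProfile a (2 * a) + ∫ τ in (2 * a)..s, angStep a τ :=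
      (intervalIntegral.integral_add_adjacent_intervals (hc.intervalIntegrable _ _)
        (hc.intervalIntegrable _ _)).symm
    have e2 : ∫ τ in (2 * a)..s, angStep a τ = s - 2 * a := by
      rw [intervalIntegral.integral_congr (g := fun _ => (1 : ℝ))]
      · simp
      · intro τ hτ
        rw [uIcc_of_le hs] at hτ
        exact angStep_eq_one ha hτ.1
    have : 0 ≤ angProfile a (2 * a) :=
      intervalIntegral.integral_nonneg (by positivity) fun τ _ => angStep_nonneg a τ
    linarith

/-- The spherical Rayleigh quotient of the angular profile exceeds `n - 1` by `O(a)`. -/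
lemma sphereInt_angStep_le (hn : 1 ≤ n) {e : EuclideanSpace ℝ (Fin n)} (he : ‖e‖ = 1) {a : ℝ}
    (ha : 0 < a) : sphereInt e (fun s => angStep a s ^ 2 * (1 - s ^ 2))
      ≤ (n - 1) * (sphereInt e (fun s => angProfile a s ^ 2)
        + 4 * a * sphereInt e (fun _ => 1)) := by
  have hc := (contDiff_angStep a).continuous
  have hcp := (contDiff_angProfile a).continuous
  -- Choosing `ξ' = ζ'²`, with `ζ = angProfile a`, turns the angular energy into `(n - 1) ∫ sξ`. It
  -- then suffices that `sξ ≤ s² ≤ ζ² + 4a` for `0 ≤ s ≤ 1`, which follows from `ζ ≥ s - 2a`.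
  set ξ : ℝ → ℝ := fun s => ∫ τ in (0 : ℝ)..s, angStep a τ ^ 2 with hξ
  have hd : ∀ s, HasDerivAt ξ (angStep a s ^ 2) s := fun s =>
    intervalIntegral.integral_hasDerivAt_right ((hc.pow 2).intervalIntegrable _ _)
      (hc.pow 2).aestronglyMeasurable.stronglyMeasurableAtFilter (hc.pow 2).continuousAt
  have hξc : Continuous ξ := continuous_iff_continuousAt.2 fun s => (hd s).continuousAt
  rw [sphereInt_deriv_mul hn he hd (hc.pow 2), ← sphereInt_const_mul e (4 * a),
    ← sphereInt_add e (by fun_prop) (by fun_prop)]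
  have hn' : (1 : ℝ) ≤ n := by exact_mod_cast hn
  refine mul_le_mul_of_nonneg_left ?_ (by linarith)
  refine sphereInt_mono he (by fun_prop) (by fun_prop) fun s hs => ?_
  rcases le_total s 0 with h0 | h0
  · have : ξ s = 0 := by
      refine intervalIntegral.integral_zero_ae (.of_forall fun τ hτ => ?_)
      rw [uIoc_of_ge h0] at hτ
      rw [angStep_eq_zero ha (hτ.2.trans ha.le)]; simp
    rw [this, mul_zero]
    positivity
  · have h1 : ξ s ≤ s := by
      calc ξ s ≤ ∫ _ in (0 : ℝ)..s, (1 : ℝ) := by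
            refine intervalIntegral.integral_mono_on h0 ((hc.pow 2).intervalIntegrable _ _)
              (by simp) fun τ _ => ?_
            exact pow_le_one₀ (angStep_nonneg a τ) (angStep_le_one a τ)
        _ = s := by simp
    have h2 : s * ξ s ≤ s * s := by gcongr
    have h3 := angProfile_ge ha h0
    rcases le_total s (2 * a) with h4 | h4
    · nlinarith [sq_nonneg (angProfile a s)]
    · nlinarith

/-- For `a ≤ 1/4` the profile dominates `max (s - 1/2) 0`, whose integral does not depend on `a`. -/
lemma exists_sphereInt_angProfile_ge (hn : 1 ≤ n) {e : EuclideanSpace ℝ (Fin n)}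
    (he : ‖e‖ = 1) : ∃ c > 0, ∀ a, 0 < a → a ≤ 1 / 4 →
      c ≤ sphereInt e (fun s => angProfile a s ^ 2) := by
  refine ⟨sphereInt e (fun s => max (s - 1 / 2) 0 ^ 2),
    sphereInt_pos hn he (by fun_prop) (fun s => by positivity) (by norm_num), fun a ha ha4 => ?_⟩
  have hcp := (contDiff_angProfile a).continuous
  refine sphereInt_mono he (by fun_prop) (by fun_prop) fun s _ => ?_
  rcases le_total s (1 / 2) with h | h
  · rw [max_eq_right (by linarith)]
    simp only [ne_eq, OfNat.ofNat_ne_zero, not_false_eq_true, zero_pow]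
    positivity
  · rw [max_eq_left (by linarith)]
    have := angProfile_ge ha (by linarith : 0 ≤ s)
    gcongr; linarith

/-! ### Growth of the iterated logarithms near zero -/

lemma exists_X_eq (k : ℕ) {y : ℝ} (h0 : 0 < y) (h1 : y ≤ 1) : ∃ t, 0 < t ∧ t ≤ 1 ∧ X k t = y := by
  induction k with
  | zero => exact ⟨y, h0, h1, rfl⟩
  | succ k ih =>
    obtain ⟨s, hs0, hs1, hs⟩ := ih
    have : 1 ≤ 1 / s := (one_le_div hs0).2 hs1
    refine ⟨Real.exp (1 - 1 / s), Real.exp_pos _, Real.exp_le_one_iff.2 (by linarith), ?_⟩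
    rw [X_succ, X₁, Real.log_exp, sub_sub_cancel, one_div_one_div, hs]

lemma tendsto_X₁_zero : Tendsto X₁ (𝓝[>] 0) (𝓝[>] 0) := by
  have h : Tendsto (fun t => 1 - Real.log t) (𝓝[>] 0) atTop :=
    tendsto_atTop_add_const_left _ 1 (tendsto_neg_atBot_atTop.comp Real.tendsto_log_nhdsGT_zero)
  have := tendsto_inv_atTop_nhdsGT_zero.comp h
  refine this.congr fun t => ?_
  simp [X₁]

/-- The left side is `√(e/t)`. -/
lemma eventually_exp_le {c : ℝ} (hc : 0 < c) :
    ∀ᶠ t in 𝓝[>] (0 : ℝ), Real.exp ((1 - Real.log t) / 2) ≤ c / t := by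
  have h1 : ∀ᶠ t in 𝓝[>] (0 : ℝ), t ∈ Ioo 0 (c ^ 2 / Real.exp 1) :=
    Ioo_mem_nhdsGT (by positivity)
  filter_upwards [h1] with t ht
  have ht0 : 0 < t := ht.1
  refine le_of_sq_le_sq ?_ (by positivity)
  have e1 : Real.exp ((1 - Real.log t) / 2) ^ 2 = Real.exp 1 / t := by
    rw [← Real.exp_nat_mul, ← Real.exp_log ht0, ← Real.exp_sub, Real.log_exp]
    congr 1
    push_cast
    ring
  rw [e1, div_pow, div_le_div_iff₀ ht0 (by positivity)]
  have := (lt_div_iff₀ (Real.exp_pos 1)).1 ht.2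
  nlinarith

/-- Comparability after `m` logarithms still allows `t` to be far smaller than `t₂`, but not below
`e^{-c/t₂}`. One step of the induction applies the bound with exponent `1/2` to `X₁ t`, giving `1 -
log t ≤ √(e/t₂) ≤ c/t₂`. -/
lemma eventually_inv_le_exp {K : ℝ} (hK : 0 < K) (m : ℕ) {c : ℝ} (hc : 0 < c) :
    ∀ᶠ t₂ in 𝓝[>] (0 : ℝ), ∀ t, 0 < t → t ≤ 1 → X m t₂ ≤ K * X m t →
      1 / t ≤ Real.exp (c / t₂) := by
  induction m generalizing c with
  | zero =>
    have h1 : ∀ᶠ t in 𝓝[>] (0 : ℝ), t ∈ Ioo 0 (c ^ 2 / (2 * K)) := Ioo_mem_nhdsGT (by positivity)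
    filter_upwards [h1] with t₂ ht₂ t ht0 _ hle
    have ht₂0 : 0 < t₂ := ht₂.1
    rw [X_zero, X_zero] at hle
    have h2 := Real.quadratic_le_exp_of_nonneg (div_nonneg hc.le ht₂0.le)
    refine le_trans ?_ h2
    have h3 : 1 / t ≤ K / t₂ := by
      rw [div_le_div_iff₀ ht0 ht₂0]; linarith
    have h4 : K / t₂ ≤ (c / t₂) ^ 2 / 2 := by
      have := (lt_div_iff₀ (by positivity)).1 ht₂.2
      rw [div_pow, div_div, div_le_div_iff₀ ht₂0 (by positivity)]
      nlinarith
    have : 0 < c / t₂ := by positivity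
    linarith
  | succ m ih =>
    filter_upwards [tendsto_X₁_zero.eventually (ih (c := 1 / 2) (by norm_num)),
      eventually_exp_le hc] with t₂ h1 h2 t ht0 ht1 hle
    have h3 := h1 (X₁ t) (X₁_pos ht0 ht1) (X₁_le_one ht0 ht1) hle
    rw [X₁, one_div_one_div, X₁, div_div_eq_mul_div, div_one] at h3
    have h4 : -Real.log t ≤ c / t₂ := by
      rw [show (1 / 2 * (1 - Real.log t₂)) = (1 - Real.log t₂) / 2 by ring] at h3
      linarith
    rw [one_div, ← Real.exp_log (inv_pos.2 ht0), Real.log_inv]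
    exact Real.exp_le_exp.2 h4

/-- Applying the previous bound to `X₁ t` shows that `1/X₁ t` is at most a small power of `e/t₂`.
The exponent `1/(4(k + 1))` is chosen so that the `2(k + 1)` factors bounding `1/prodX²` total
`√(e/t₂)`. -/
lemma eventually_le_prodX_sq {K : ℝ} (hK : 0 < K) {m : ℕ} (hm : 1 ≤ m) {c : ℝ} (hc : 0 < c) :
    ∀ᶠ t₂ in 𝓝[>] (0 : ℝ), ∀ t, 0 < t → t ≤ 1 → X m t₂ ≤ K * X m t →
      t₂ ≤ c * prodX m t ^ 2 := by
  obtain ⟨k, rfl⟩ : ∃ k, m = k + 1 := ⟨m - 1, by omega⟩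
  have hpos : (0 : ℝ) < 4 * (k + 1) := by positivity
  filter_upwards [tendsto_X₁_zero.eventually
      (eventually_inv_le_exp hK k (c := 1 / (4 * (k + 1))) (by positivity)),
    eventually_exp_le hc, self_mem_nhdsWithin] with t₂ h1 h2 ht₂ t ht0 ht1 hle
  have hX := X₁_pos ht0 ht1
  have h3 := h1 (X₁ t) hX (X₁_le_one ht0 ht1) hle
  rw [show X₁ t₂ = 1 / (1 - Real.log t₂) from rfl, div_div_eq_mul_div, div_one] at h3
  have h4 : 1 / prodX (k + 1) t ^ 2 ≤ Real.exp ((1 - Real.log t₂) / 2) := by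
    calc 1 / prodX (k + 1) t ^ 2 ≤ 1 / (X₁ t ^ (k + 1)) ^ 2 := by
          have := X₁_pow_le_prodX (k + 1) ht0 ht1
          gcongr
      _ = (1 / X₁ t) ^ (2 * (k + 1)) := by rw [one_div_pow, ← pow_mul, mul_comm (k + 1)]
      _ ≤ Real.exp (1 / (4 * (k + 1)) * (1 - Real.log t₂)) ^ (2 * (k + 1)) := by gcongr
      _ = Real.exp ((1 - Real.log t₂) / 2) := by
          rw [← Real.exp_nat_mul]
          congr 1
          push_cast
          field_simp
          norm_num
  have h5 := h4.trans h2
  have hp := prodX_pos (k + 1) ht0 ht1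
  rw [div_le_div_iff₀ (by positivity) ht₂] at h5
  linarith

/-- As `1/X_{m+1} = 1 - log X_m`, an additive window of length `N` for the former is a
multiplicative window `e^N` for the latter. -/
lemma X_le_exp_mul_of_inv_le {m : ℕ} {N t t₂ : ℝ} (ht0 : 0 < t) (ht1 : t ≤ 1) (ht₂0 : 0 < t₂)
    (ht₂1 : t₂ ≤ 1) (h : 1 / X (m + 1) t ≤ 1 / X (m + 1) t₂ + N) :
    X m t₂ ≤ Real.exp N * X m t := by
  rw [X_succ', X₁, one_div_one_div, X_succ', X₁, one_div_one_div] at h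
  have h1 := X_pos m ht0 ht1
  have h2 := X_pos m ht₂0 ht₂1
  rw [← Real.exp_log h1, ← Real.exp_log h2, ← Real.exp_add]
  exact Real.exp_le_exp.2 (by linarith)

/-! ### Radial integrals -/

section Radial

variable {L r : ℝ}

lemma hasDerivAt_comp_div_const {F : ℝ → ℝ} {F' : ℝ} (hL : 0 < L)
    (h : HasDerivAt F (F' / (r / L)) (r / L)) :
    HasDerivAt (fun s => F (s / L)) (F' / r) r := by
  have := HasDerivAt.comp (h₂ := F) r h ((hasDerivAt_id r).div_const L)
  refine this.congr_deriv ?_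
  field_simp

lemma hasDerivAt_prodX_div (m : ℕ) (hr : 0 < r) (hL : r < L) :
    HasDerivAt (fun s => prodX m (s / L)) (prodX m (r / L) * sumX m (r / L) / r) r :=
  hasDerivAt_comp_div_const (hr.trans hL)
    (hasDerivAt_prodX m (div_pos hr (hr.trans hL)) ((div_lt_one (hr.trans hL)).2 hL))

lemma hasDerivAt_sumX_div (m : ℕ) (hr : 0 < r) (hL : r < L) :
    HasDerivAt (fun s => sumX m (s / L))
      ((sumX m (r / L) ^ 2 + sumSqX m (r / L)) / 2 / r) r :=
  hasDerivAt_comp_div_const (hr.trans hL)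
    (hasDerivAt_sumX m (div_pos hr (hr.trans hL)) ((div_lt_one (hr.trans hL)).2 hL))

lemma hasDerivAt_inv_X_div (m : ℕ) (hr : 0 < r) (hL : r < L) :
    HasDerivAt (fun s => 1 / X (m + 1) (s / L)) (-(prodX m (r / L) / r)) r := by
  have hL0 := hr.trans hL
  have h1 : 0 < r / L := div_pos hr hL0
  have h2 : r / L < 1 := (div_lt_one hL0).2 hL
  have hX := X_pos (m + 1) h1 h2.le
  have h3 := (hasDerivAt_comp_div_const hL0 (hasDerivAt_X m h1 h2)).fun_inv hX.ne'
  refine (h3.congr_of_eventuallyEq (.of_forall fun s => one_div _)).congr_deriv ?_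
  field_simp

lemma continuousOn_prodX_div (m : ℕ) {r₁ r₂ : ℝ} (h1 : 0 < r₁) (h2 : r₂ < L) :
    ContinuousOn (fun s => prodX m (s / L)) (Icc r₁ r₂) := fun _ hr =>
  (hasDerivAt_prodX_div m (h1.trans_le hr.1) (hr.2.trans_lt h2)).continuousAt.continuousWithinAt

lemma continuousOn_sumX_div (m : ℕ) {r₁ r₂ : ℝ} (h1 : 0 < r₁) (h2 : r₂ < L) :
    ContinuousOn (fun s => sumX m (s / L)) (Icc r₁ r₂) := fun _ hr =>
  (hasDerivAt_sumX_div m (h1.trans_le hr.1) (hr.2.trans_lt h2)).continuousAt.continuousWithinAt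

lemma prodX_div_pos (m : ℕ) (hr : 0 < r) (hL : r < L) : 0 < prodX m (r / L) :=
  prodX_pos m (div_pos hr (hr.trans hL)) ((div_le_one (hr.trans hL)).2 hL.le)

/-- The radial identity obtained by completing the square. -/
lemma integral_radial_sq {m : ℕ} {b r₁ r₂ : ℝ} (h1 : 0 < r₁) (h12 : r₁ ≤ r₂) (h2 : r₂ < L)
    {W W' : ℝ → ℝ} (hW : ∀ r, HasDerivAt W (W' r) r) (hW' : Continuous W') (hW1 : W r₁ = 0)
    (hW2 : W r₂ = 0) :
    ∫ r in r₁..r₂, ((b - sumX m (r / L) / 2) * W r + r * W' r) ^ 2 / (prodX m (r / L) * r)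
      = b ^ 2 * (∫ r in r₁..r₂, W r ^ 2 / (prodX m (r / L) * r))
        + 1 / 4 * ∑ i ∈ Finset.Icc 1 m,
          (∫ r in r₁..r₂, prodX i (r / L) ^ 2 * (W r ^ 2 / (prodX m (r / L) * r)))
        + ∫ r in r₁..r₂, r * W' r ^ 2 / prodX m (r / L) := by
  have hWc : Continuous W := continuous_iff_continuousAt.2 fun r => (hW r).continuousAt
  have hp := fun i => continuousOn_prodX_div (L := L) i h1 h2
  have hs := continuousOn_sumX_div (L := L) m h1 h2
  have hp0 : ∀ r ∈ Icc r₁ r₂, prodX m (r / L) ≠ 0 := fun r hr =>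
    (prodX_div_pos m (h1.trans_le hr.1) (hr.2.trans_lt h2)).ne'
  have hr0 : ∀ r ∈ Icc r₁ r₂, r ≠ 0 := fun r hr => (h1.trans_le hr.1).ne'
  have hpr0 : ∀ r ∈ Icc r₁ r₂, prodX m (r / L) * r ≠ 0 := fun r hr =>
    mul_ne_zero (hp0 r hr) (hr0 r hr)
  have hid : ContinuousOn (fun r : ℝ => r) (Icc r₁ r₂) := continuousOn_id
  have cW : ContinuousOn (fun r => W r ^ 2 / (prodX m (r / L) * r)) (Icc r₁ r₂) :=
    (hWc.continuousOn.pow 2).div ((hp m).mul hid) hpr0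
  have cW' : ContinuousOn (fun r => r * W' r ^ 2 / prodX m (r / L)) (Icc r₁ r₂) :=
    (hid.mul (hW'.continuousOn.pow 2)).div (hp m) hp0
  have cL : ContinuousOn (fun r => ((b - sumX m (r / L) / 2) * W r + r * W' r) ^ 2 /
      (prodX m (r / L) * r)) (Icc r₁ r₂) :=
    (((((continuousOn_const.sub (hs.div_const 2)).mul hWc.continuousOn).add
      (hid.mul hW'.continuousOn))).pow 2).div ((hp m).mul hid) hpr0
  have ii : ∀ {g : ℝ → ℝ}, ContinuousOn g (Icc r₁ r₂) → IntervalIntegrable g volume r₁ r₂ :=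
    fun hg => ContinuousOn.intervalIntegrable (by rwa [uIcc_of_le h12])
  have iR1 := (ii cW).const_mul (b ^ 2)
  have iRi : ∀ i, IntervalIntegrable (fun r =>
      prodX i (r / L) ^ 2 * (W r ^ 2 / (prodX m (r / L) * r))) volume r₁ r₂ :=
    fun i => ii (((hp i).pow 2).mul cW)
  have iR2 : IntervalIntegrable (fun r => 1 / 4 * ∑ i ∈ Finset.Icc 1 m,
      prodX i (r / L) ^ 2 * (W r ^ 2 / (prodX m (r / L) * r))) volume r₁ r₂ :=
    ii (continuousOn_const.mul (continuousOn_finsetSum _ fun i _ => ((hp i).pow 2).mul cW))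
  have iR3 := ii cW'
  have hFTC : ∫ r in r₁..r₂, (((b - sumX m (r / L) / 2) * W r + r * W' r) ^ 2 /
      (prodX m (r / L) * r) - (b ^ 2 * (W r ^ 2 / (prodX m (r / L) * r)) + 1 / 4 *
        (∑ i ∈ Finset.Icc 1 m, prodX i (r / L) ^ 2 * (W r ^ 2 / (prodX m (r / L) * r)))
        + r * W' r ^ 2 / prodX m (r / L))) = 0 := by
    -- By the Riccati identity the difference of the two sides is the derivative of `(b - η/2)
    -- W²/prodX m`, which vanishes at both endpoints.
    rw [intervalIntegral.integral_eq_sub_of_hasDerivAt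
      (f := fun r => (b - sumX m (r / L) / 2) * W r ^ 2 / prodX m (r / L))]
    · simp [hW1, hW2]
    · intro r hr
      rw [uIcc_of_le h12] at hr
      have hr' := h1.trans_le hr.1
      have hrL := hr.2.trans_lt h2
      have hpp := prodX_div_pos m hr' hrL
      have := ((((hasDerivAt_sumX_div m hr' hrL).div_const 2).const_sub b).fun_mul
        ((hW r).fun_pow 2)).fun_div (hasDerivAt_prodX_div m hr' hrL) hpp.ne'
      refine this.congr_deriv ?_
      rw [← Finset.sum_mul, ← sumSqX]
      simp only [Nat.cast_ofNat, Nat.add_one_sub_one, pow_one]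
      field_simp
      ring
    · exact (ii cL).sub ((iR1.add iR2).add iR3)
  rw [intervalIntegral.integral_sub (ii cL) ((iR1.add iR2).add iR3),
    intervalIntegral.integral_add (iR1.add iR2) iR3, intervalIntegral.integral_add iR1 iR2,
    intervalIntegral.integral_const_mul, intervalIntegral.integral_const_mul,
    intervalIntegral.integral_finsetSum fun i _ => iRi i] at hFTC
  linarith

/-- The substitution `s = 1/X_{m+1}(r/L)`, for which `ds = -(X_1 ⋯ X_m) dr/r`; it reverses
orientation. -/
lemma integral_comp_inv_X {m : ℕ} {r₁ r₂ : ℝ} (h1 : 0 < r₁) (h12 : r₁ ≤ r₂) (h2 : r₂ < L)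
    {G : ℝ → ℝ} (hG : Continuous G) :
    ∫ r in r₁..r₂, G (1 / X (m + 1) (r / L)) * (prodX m (r / L) / r)
      = ∫ s in (1 / X (m + 1) (r₂ / L))..(1 / X (m + 1) (r₁ / L)), G s := by
  have hd : ∀ r ∈ uIcc r₁ r₂, HasDerivAt (fun s => 1 / X (m + 1) (s / L))
      (-(prodX m (r / L) / r)) r := by
    intro r hr
    rw [uIcc_of_le h12] at hr
    exact hasDerivAt_inv_X_div m (h1.trans_le hr.1) (hr.2.trans_lt h2)
  have := intervalIntegral.integral_comp_mul_deriv hd (g := G) (by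
    rw [uIcc_of_le h12]
    exact ((continuousOn_prodX_div m h1 h2).div continuousOn_id
      fun r hr => (h1.trans_le hr.1).ne').neg) hG
  rw [intervalIntegral.integral_symm (1 / X (m + 1) (r₁ / L)), ← this, ← intervalIntegral.integral_neg]
  refine intervalIntegral.integral_congr fun r _ => ?_
  simp

/-- The function `y(1 / X_{m+1}(r / L))`, set to zero outside `(r₁, r₂)`. -/
noncomputable def logPullback (m : ℕ) (L r₁ r₂ : ℝ) (y : ℝ → ℝ) : ℝ → ℝ :=
  (Ioo r₁ r₂).indicator fun r => y (1 / X (m + 1) (r / L))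

variable {m : ℕ} {r₁ r₂ : ℝ} {y : ℝ → ℝ}

lemma tsupport_logPullback_subset (h1 : 0 < r₁) (h2 : r₂ < L)
    (hy : tsupport y ⊆ Ioo (1 / X (m + 1) (r₂ / L)) (1 / X (m + 1) (r₁ / L))) :
    tsupport (logPullback m L r₁ r₂ y) ⊆ Ioo r₁ r₂ := by
  have hc : ContinuousOn (fun s => 1 / X (m + 1) (s / L)) (Icc r₁ r₂) := fun r hr =>
    (hasDerivAt_inv_X_div m (h1.trans_le hr.1) (hr.2.trans_lt h2)).continuousAt.continuousWithinAt
  have hcl := hc.preimage_isClosed_of_isClosed isClosed_Icc (isClosed_tsupport y)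
  refine (closure_minimal (fun r hr => ?_) hcl).trans fun r hr => ?_
  · have hr1 : r ∈ Ioo r₁ r₂ := by
      by_contra h
      exact hr (indicator_of_notMem h _)
    rw [Function.mem_support, logPullback, indicator_of_mem hr1] at hr
    exact ⟨Ioo_subset_Icc_self hr1, subset_tsupport _ hr⟩
  · have := hy hr.2
    refine ⟨hr.1.1.lt_of_ne ?_, hr.1.2.lt_of_ne ?_⟩
    · rintro rfl; exact this.2.false
    · rintro rfl; exact this.1.false

lemma logPullback_eq (hy : tsupport y ⊆ Ioo (1 / X (m + 1) (r₂ / L)) (1 / X (m + 1) (r₁ / L)))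
    {r : ℝ} (hr : r ∈ Icc r₁ r₂) : logPullback m L r₁ r₂ y r = y (1 / X (m + 1) (r / L)) := by
  by_cases h : r ∈ Ioo r₁ r₂
  · exact indicator_of_mem h _
  · rw [logPullback, indicator_of_notMem h]
    refine (image_eq_zero_of_notMem_tsupport fun h' => ?_).symm
    rcases hr.1.eq_or_lt with rfl | h1
    · exact (hy h').2.false
    · rcases hr.2.eq_or_lt with rfl | h2
      · exact (hy h').1.false
      · exact h ⟨h1, h2⟩

lemma contDiff_logPullback (h1 : 0 < r₁) (h2 : r₂ < L) (hyc : ContDiff ℝ ∞ y)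
    (hy : tsupport y ⊆ Ioo (1 / X (m + 1) (r₂ / L)) (1 / X (m + 1) (r₁ / L))) :
    ContDiff ℝ ∞ (logPullback m L r₁ r₂ y) := by
  rw [contDiff_iff_contDiffAt]
  intro r
  by_cases hr : r ∈ tsupport (logPullback m L r₁ r₂ y)
  · have hr' := tsupport_logPullback_subset h1 h2 hy hr
    have hr0 := h1.trans hr'.1
    have hrL := hr'.2.trans h2
    have hL0 := hr0.trans hrL
    have hX : ContDiffAt ℝ ∞ (fun s => X (m + 1) (s / L)) r :=
      ContDiffAt.comp (g := X (m + 1)) r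
        (contDiffAt_X (m + 1) (div_pos hr0 hL0) ((div_lt_one hL0).2 hrL))
        (contDiffAt_id.div_const L)
    have hX0 := X_pos (m + 1) (div_pos hr0 hL0) ((div_le_one hL0).2 hrL.le)
    have : ContDiffAt ℝ ∞ (fun s => y (1 / X (m + 1) (s / L))) r :=
      hyc.contDiffAt.comp r (contDiffAt_const.div hX hX0.ne')
    refine this.congr_of_eventuallyEq ?_
    filter_upwards [isOpen_Ioo.mem_nhds hr'] with s hs
    exact indicator_of_mem hs _
  · exact contDiffAt_const.congr_of_eventuallyEq (notMem_tsupport_iff_eventuallyEq.1 hr)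

lemma deriv_logPullback (h1 : 0 < r₁) (h2 : r₂ < L) (hyc : ContDiff ℝ ∞ y)
    (hy : tsupport y ⊆ Ioo (1 / X (m + 1) (r₂ / L)) (1 / X (m + 1) (r₁ / L)))
    {r : ℝ} (hr : r ∈ Icc r₁ r₂) : deriv (logPullback m L r₁ r₂ y) r
      = deriv y (1 / X (m + 1) (r / L)) * -(prodX m (r / L) / r) := by
  by_cases h : r ∈ Ioo r₁ r₂
  · have h3 := HasDerivAt.comp (h₂ := y) r
      (hyc.differentiable (by simp) (1 / X (m + 1) (r / L))).hasDerivAt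
      (hasDerivAt_inv_X_div m (h1.trans h.1) (h.2.trans h2))
    rw [← h3.deriv]
    refine Filter.EventuallyEq.deriv_eq ?_
    filter_upwards [isOpen_Ioo.mem_nhds h] with s hs
    exact indicator_of_mem hs _
  · have h4 : deriv (logPullback m L r₁ r₂ y) r = 0 := by
      rw [(notMem_tsupport_iff_eventuallyEq.1 fun h' =>
        h (tsupport_logPullback_subset h1 h2 hy h')).deriv_eq]
      simp
    have h5 : deriv y (1 / X (m + 1) (r / L)) = 0 := by
      rw [(notMem_tsupport_iff_eventuallyEq.1 fun h' => ?_).deriv_eq]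
      · simp
      · rcases hr.1.eq_or_lt with rfl | h6
        · exact (hy h').2.false
        · rcases hr.2.eq_or_lt with rfl | h7
          · exact (hy h').1.false
          · exact h ⟨h6, h7⟩
    rw [h4, h5, zero_mul]

end Radial

/-! ### Functions with separated radial and angular variables -/

/-- The function `f(|x|) ζ(⟨e, x⟩ / |x|)`. -/
noncomputable def sepFun (e : EuclideanSpace ℝ (Fin n)) (f ζ : ℝ → ℝ)
    (x : EuclideanSpace ℝ (Fin n)) : ℝ := f ‖x‖ * ζ (cosAngle e x)

section Separated

variable {e : EuclideanSpace ℝ (Fin n)} {f ζ : ℝ → ℝ} {r₁ r₂ : ℝ}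

lemma tsupport_comp_norm_subset (f : ℝ → ℝ) :
    tsupport (fun x : EuclideanSpace ℝ (Fin n) => f ‖x‖) ⊆ {x | ‖x‖ ∈ tsupport f} :=
  closure_minimal (fun _ hx => subset_tsupport f hx)
    ((isClosed_tsupport f).preimage continuous_norm)

lemma ne_zero_of_norm_mem {x : EuclideanSpace ℝ (Fin n)} (h1 : 0 < r₁)
    (hf : tsupport f ⊆ Ioo r₁ r₂) (hx : ‖x‖ ∈ tsupport f) : x ≠ 0 :=
  norm_pos_iff.1 (h1.trans (hf hx).1)

lemma contDiff_comp_norm (h1 : 0 < r₁) (hf : tsupport f ⊆ Ioo r₁ r₂) (hfc : ContDiff ℝ ∞ f) :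
    ContDiff ℝ ∞ fun x : EuclideanSpace ℝ (Fin n) => f ‖x‖ := by
  rw [contDiff_iff_contDiffAt]
  intro x
  by_cases hx : x ∈ tsupport fun x : EuclideanSpace ℝ (Fin n) => f ‖x‖
  · exact hfc.contDiffAt.comp x (contDiffAt_norm ℝ
      (ne_zero_of_norm_mem h1 hf (tsupport_comp_norm_subset f hx)))
  · exact contDiffAt_const.congr_of_eventuallyEq (notMem_tsupport_iff_eventuallyEq.1 hx)

lemma hasCompactSupport_comp_norm (hf : tsupport f ⊆ Ioo r₁ r₂) :
    HasCompactSupport fun x : EuclideanSpace ℝ (Fin n) => f ‖x‖ := by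
  refine HasCompactSupport.of_support_subset_isCompact
    (isCompact_closedBall (0 : EuclideanSpace ℝ (Fin n)) r₂) fun x hx => ?_
  rw [mem_closedBall_zero_iff]
  exact (hf (subset_tsupport f hx)).2.le

lemma contDiff_sepFun (h1 : 0 < r₁) (hf : tsupport f ⊆ Ioo r₁ r₂) (hfc : ContDiff ℝ ∞ f)
    (hζ : ContDiff ℝ ∞ ζ) : ContDiff ℝ ∞ (sepFun e f ζ) :=
  contDiff_mul_of_tsupport_subset (contDiff_comp_norm h1 hf hfc) (tsupport_comp_norm_subset f)
    fun x hx => hζ.contDiffAt.comp x (contDiffAt_cosAngle e (ne_zero_of_norm_mem h1 hf hx))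

lemma integrable_cosAngle_mul_norm (h1 : 0 < r₁) {k H : ℝ → ℝ} (hk : Continuous k)
    (hH : Continuous H) (hHs : tsupport H ⊆ Ioo r₁ r₂) :
    Integrable fun x : EuclideanSpace ℝ (Fin n) => k (cosAngle e x) * H ‖x‖ := by
  have hc : Continuous fun x : EuclideanSpace ℝ (Fin n) => H ‖x‖ * k (cosAngle e x) :=
    continuous_mul_of_tsupport_subset (hH.comp continuous_norm) (tsupport_comp_norm_subset H)
      fun x hx => hk.continuousAt.comp
        (contDiffAt_cosAngle e (ne_zero_of_norm_mem h1 hHs hx) (k := 0)).continuousAt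
  simpa only [mul_comm] using
    hc.integrable_of_hasCompactSupport (hasCompactSupport_comp_norm hHs).mul_right

/-- Radial and angular parts of the gradient are orthogonal, and `|∇ cos θ|² = (1 - cos² θ)/r²`. Off
the support of `f`, in particular at the origin, both sides vanish. -/
lemma norm_gradient_sepFun_sq (he : ‖e‖ = 1) (h1 : 0 < r₁) (hf : tsupport f ⊆ Ioo r₁ r₂)
    (hfc : ContDiff ℝ ∞ f) {ζ' : ℝ → ℝ} (hζ : ∀ s, HasDerivAt ζ (ζ' s) s)
    (x : EuclideanSpace ℝ (Fin n)) :
    ‖gradient (sepFun e f ζ) x‖ ^ 2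
      = (fun s => ζ' s ^ 2 * (1 - s ^ 2)) (cosAngle e x) * (f ‖x‖ ^ 2 / ‖x‖ ^ 2)
        + (fun s => ζ s ^ 2) (cosAngle e x) * deriv f ‖x‖ ^ 2 := by
  by_cases hx : ‖x‖ ∈ tsupport f
  · have hx0 := ne_zero_of_norm_mem h1 hf hx
    have hr : ‖x‖ ≠ 0 := norm_ne_zero_iff.2 hx0
    have hfd : HasFDerivAt (fun y : EuclideanSpace ℝ (Fin n) => f ‖y‖) _ x :=
      HasDerivAt.comp_hasFDerivAt (f := fun y : EuclideanSpace ℝ (Fin n) => ‖y‖) x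
        (hfc.differentiable (by simp) ‖x‖).hasDerivAt (hasFDerivAt_norm hx0)
    have hζd : HasFDerivAt (fun y => ζ (cosAngle e y)) _ x :=
      HasDerivAt.comp_hasFDerivAt (f := cosAngle e) x (hζ _) (hasFDerivAt_cosAngle e hx0)
    have hu := (hfd.fun_mul hζd).fderiv
    set s := cosAngle e x with hs
    set A := f ‖x‖ * ζ' s * ‖x‖⁻¹ with hA
    set B := -(f ‖x‖ * ζ' s * (s / ‖x‖ ^ 2)) + ζ s * deriv f ‖x‖ * ‖x‖⁻¹ with hB
    have hgrad : gradient (sepFun e f ζ) x = A • e + B • x := by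
      refine ext_inner_right ℝ fun y => ?_
      rw [inner_gradient]
      refine (congrArg (fun T => T y) hu).trans ?_
      simp [inner_add_left, inner_smul_left, hA, hB]
      ring
    have hin : inner ℝ e x = s * ‖x‖ := by rw [hs, cosAngle]; field_simp
    rw [hgrad, norm_add_sq_real, norm_smul, norm_smul, inner_smul_left, inner_smul_right, mul_pow,
      mul_pow, he, Real.norm_eq_abs, Real.norm_eq_abs, sq_abs, sq_abs, hin, hA, hB]
    simp only [conj_trivial]
    field_simp
    ring
  · have h2 : x ∉ tsupport (sepFun e f ζ) := fun h =>
      hx (tsupport_comp_norm_subset f (tsupport_mul_subset_left h))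
    have h3 : f ‖x‖ = 0 := image_eq_zero_of_notMem_tsupport hx
    have h4 : deriv f ‖x‖ = 0 := by
      rw [(notMem_tsupport_iff_eventuallyEq.1 hx).deriv_eq]; simp
    rw [norm_gradient, fderiv_of_notMem_tsupport _ h2, h3, h4]
    simp

lemma integral_Ioi_eq_intervalIntegral (h1 : 0 < r₁) (h12 : r₁ ≤ r₂) {H : ℝ → ℝ}
    (hH : ∀ r, r ∉ Ioo r₁ r₂ → H r = 0) :
    ∫ r in Ioi (0 : ℝ), r ^ (n - 1) * H r = ∫ r in r₁..r₂, r ^ (n - 1) * H r := by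
  rw [intervalIntegral.integral_of_le h12]
  refine setIntegral_eq_of_subset_of_forall_sdiff_eq_zero measurableSet_Ioi
    (fun r hr => h1.trans hr.1) fun r hr => ?_
  rw [hH r fun h => hr.2 (Ioo_subset_Ioc_self h), mul_zero]

lemma integral_norm_gradient_sepFun_sq (hn : 1 ≤ n) (he : ‖e‖ = 1) (h1 : 0 < r₁) (h12 : r₁ ≤ r₂)
    (hf : tsupport f ⊆ Ioo r₁ r₂) (hfc : ContDiff ℝ ∞ f) {ζ' : ℝ → ℝ}
    (hζ : ∀ s, HasDerivAt ζ (ζ' s) s) (hζ' : Continuous ζ') :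
    ∫ x, ‖gradient (sepFun e f ζ) x‖ ^ 2
      = sphereInt e (fun s => ζ' s ^ 2 * (1 - s ^ 2))
          * (∫ r in r₁..r₂, r ^ (n - 1) * (f r ^ 2 / r ^ 2))
        + sphereInt e (fun s => ζ s ^ 2) * ∫ r in r₁..r₂, r ^ (n - 1) * deriv f r ^ 2 := by
  have hζc : Continuous ζ := continuous_iff_continuousAt.2 fun s => (hζ s).continuousAt
  have hdc : Continuous (deriv f) := hfc.continuous_deriv (by simp)
  have hz : ∀ r, r ∉ tsupport f → f r = 0 ∧ deriv f r = 0 := fun r hr =>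
    ⟨image_eq_zero_of_notMem_tsupport hr, by
      rw [(notMem_tsupport_iff_eventuallyEq.1 hr).deriv_eq]; simp⟩
  have hc1 : Continuous fun r => f r ^ 2 / r ^ 2 := by
    have : Continuous fun r => f r * (f r * (r ^ 2)⁻¹) :=
      continuous_mul_of_tsupport_subset hfc.continuous hf fun r hr =>
        hfc.continuous.continuousAt.mul ((by fun_prop : ContinuousAt (fun r : ℝ => r ^ 2) r).inv₀
          (pow_ne_zero _ (h1.trans hr.1).ne'))
    refine this.congr fun r => by ring
  have hs1 : tsupport (fun r => f r ^ 2 / r ^ 2) ⊆ Ioo r₁ r₂ :=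
    (closure_minimal (fun r hr => by
      by_contra h
      exact hr (by simp [(hz r h).1])) (isClosed_tsupport f)).trans hf
  have hs2 : tsupport (fun r => deriv f r ^ 2) ⊆ Ioo r₁ r₂ :=
    (closure_minimal (fun r hr => by
      by_contra h
      exact hr (by simp [(hz r h).2])) (isClosed_tsupport f)).trans hf
  rw [integral_congr_ae (.of_forall (norm_gradient_sepFun_sq he h1 hf hfc hζ)), integral_add
    (integrable_cosAngle_mul_norm (k := fun s => ζ' s ^ 2 * (1 - s ^ 2))
      (H := fun r => f r ^ 2 / r ^ 2) h1 (by fun_prop) hc1 hs1)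
    (integrable_cosAngle_mul_norm (k := fun s => ζ s ^ 2) (H := fun r => deriv f r ^ 2) h1
      (by fun_prop) (hdc.pow 2) hs2)]
  rw [integral_cosAngle_mul_norm hn e (fun s => ζ' s ^ 2 * (1 - s ^ 2)) fun r => f r ^ 2 / r ^ 2,
    integral_cosAngle_mul_norm hn e (fun s => ζ s ^ 2) fun r => deriv f r ^ 2,
    integral_Ioi_eq_intervalIntegral h1 h12 (H := fun r => f r ^ 2 / r ^ 2) fun r hr => by
      simp [(hz r fun h => hr (hf h)).1],
    integral_Ioi_eq_intervalIntegral h1 h12 (H := fun r => deriv f r ^ 2) fun r hr => by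
      simp [(hz r fun h => hr (hf h)).2]]

lemma logHardy_sepFun (hn : 1 ≤ n) {Ω : Set (EuclideanSpace ℝ (Fin n))} (h1 : 0 < r₁)
    (h12 : r₁ ≤ r₂) (hf : tsupport f ⊆ Ioo r₁ r₂) (hΩ : tsupport (sepFun e f ζ) ⊆ Ω) (L : ℝ)
    (i : ℕ) : logHardy Ω L i (sepFun e f ζ) = sphereInt e (fun s => ζ s ^ 2)
      * ∫ r in r₁..r₂, r ^ (n - 1) * (prodX i (r / L) ^ 2 * (f r ^ 2 / r ^ 2)) := by
  rw [logHardy_eq_integral L i hΩ, ← integral_Ioi_eq_intervalIntegral h1 h12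
      (H := fun r => prodX i (r / L) ^ 2 * (f r ^ 2 / r ^ 2)) fun r hr => by
      simp [image_eq_zero_of_notMem_tsupport fun h => hr (hf h)],
    ← integral_cosAngle_mul_norm hn e (fun s => ζ s ^ 2)
      fun r => prodX i (r / L) ^ 2 * (f r ^ 2 / r ^ 2)]
  refine integral_congr_ae (.of_forall fun x => ?_)
  simp only [Finset.prod_pow, ← prodX.eq_1, sepFun]
  ring

/-- A function supported in a cone around `e` and close to the origin is supported in a ball
touching the origin. -/
lemma tsupport_sepFun_subset_ball (he : ‖e‖ = 1) {a r₀ : ℝ} (h1 : 0 < r₁) (hr₀ : 0 < r₀)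
    (hf : tsupport f ⊆ Ioo r₁ r₂) (hζ : ∀ s ≤ a, ζ s = 0) (ha : r₂ ≤ r₀ * a) :
    tsupport (sepFun e f ζ) ⊆ Metric.ball (r₀ • e) r₀ := by
  have hcl : IsClosed {x : EuclideanSpace ℝ (Fin n) | ‖x‖ ∈ tsupport f ∧ a * ‖x‖ ≤ inner ℝ e x} :=
    ((isClosed_tsupport f).preimage continuous_norm).inter
      (isClosed_le (continuous_const.mul continuous_norm) (innerSL ℝ e).continuous)
  refine (closure_minimal (fun x hx => ?_) hcl).trans fun x hx => ?_
  · have h2 := left_ne_zero_of_mul hx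
    have h3 := right_ne_zero_of_mul hx
    have h4 := subset_tsupport f h2
    have hr : 0 < ‖x‖ := h1.trans (hf h4).1
    refine ⟨h4, ?_⟩
    have h5 : a < cosAngle e x := by
      by_contra h
      exact h3 (hζ _ (not_lt.1 h))
    exact ((lt_div_iff₀ hr).1 h5).le
  · obtain ⟨hx1, hx2⟩ := hx
    have hr := hf hx1
    have hr0 := h1.trans hr.1
    rw [Metric.mem_ball, dist_eq_norm]
    refine lt_of_pow_lt_pow_left₀ 2 hr₀.le ?_
    rw [norm_sub_sq_real, inner_smul_right, norm_smul, he, Real.norm_of_nonneg hr₀.le,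
      real_inner_comm]
    -- The chain `|x|² < |x| r₂ ≤ r₀ a|x| ≤ r₀⟨e, x⟩` is more than enough, since membership in the
    -- ball only needs `|x|² < 2r₀⟨e, x⟩`.
    have h3 : ‖x‖ * r₂ ≤ ‖x‖ * (r₀ * a) := by gcongr
    have h4 : ‖x‖ * ‖x‖ < ‖x‖ * r₂ := by gcongr; exact hr.2
    have h5 : r₀ * (a * ‖x‖) ≤ r₀ * inner ℝ e x := by gcongr
    nlinarith

end Separated

/-! ### The radial profile -/

/-- The factor `r^{1 - n/2} (X_1 ⋯ X_m)^{-1/2}`. -/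
noncomputable def radialWeight (n m : ℕ) (L r : ℝ) : ℝ :=
  r ^ (1 - n / 2 : ℝ) * (√(prodX m (r / L)))⁻¹

section RadialWeight

variable {m : ℕ} {L r : ℝ}

lemma contDiffAt_radialWeight (n : ℕ) (hr : 0 < r) (hL : r < L) :
    ContDiffAt ℝ ∞ (radialWeight n m L) r := by
  have hL0 := hr.trans hL
  have hp := prodX_div_pos m hr hL
  have h1 : ContDiffAt ℝ ∞ (fun s => prodX m (s / L)) r :=
    ContDiffAt.comp (g := prodX m) r
      (contDiffAt_prodX m (div_pos hr hL0) ((div_lt_one hL0).2 hL)) (contDiffAt_id.div_const L)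
  exact (Real.contDiffAt_rpow_const_of_ne hr.ne').mul
    ((h1.sqrt hp.ne').inv (Real.sqrt_pos.2 hp).ne')

lemma hasDerivAt_radialWeight (n : ℕ) (hr : 0 < r) (hL : r < L) :
    HasDerivAt (radialWeight n m L)
      (radialWeight n m L r * ((1 - n / 2) - sumX m (r / L) / 2) / r) r := by
  have hp := prodX_div_pos m hr hL
  have hsq := Real.sqrt_pos.2 hp
  have h1 := Real.hasDerivAt_rpow_const (x := r) (p := 1 - n / 2) (Or.inl hr.ne')
  have h2 := ((hasDerivAt_prodX_div m hr hL).sqrt hp.ne').fun_inv hsq.ne'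
  refine (h1.fun_mul h2).congr_deriv ?_
  rw [Real.rpow_sub_one hr.ne', radialWeight]
  have h3 : prodX m (r / L) = √(prodX m (r / L)) ^ 2 := (Real.sq_sqrt hp.le).symm
  generalize √(prodX m (r / L)) = q at *
  rw [h3]
  field_simp
  ring

/-- The reason for the exponent `1 - n/2`: it makes the Hardy density in polar coordinates
scale-invariant, up to the logarithmic factor. -/
lemma pow_mul_radialWeight_sq (hn : 1 ≤ n) (hr : 0 < r) (hL : r < L) :
    r ^ (n - 1) * (radialWeight n m L r ^ 2 / r ^ 2) = 1 / (prodX m (r / L) * r) := by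
  have hp := prodX_div_pos m hr hL
  have h1 : (r ^ (1 - n / 2 : ℝ)) ^ 2 = r ^ 2 / r ^ n := by
    rw [← Real.rpow_natCast, ← Real.rpow_mul hr.le, ← Real.rpow_natCast r n,
      ← Real.rpow_natCast r 2, ← Real.rpow_sub hr]
    congr 1
    push_cast
    ring
  have h2 : r ^ n = r ^ (n - 1) * r := by rw [← pow_succ, Nat.sub_add_cancel hn]
  rw [radialWeight, mul_pow, h1, inv_pow, Real.sq_sqrt hp.le, h2]
  field_simp

end RadialWeight

/-! ### Sharpness -/

/-- The energies of the separated test functions. -/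
lemma energies_sepFun (hn : 1 ≤ n) {e : EuclideanSpace ℝ (Fin n)} (he : ‖e‖ = 1) {m : ℕ}
    {L r₁ r₂ : ℝ} (h1 : 0 < r₁) (h12 : r₁ ≤ r₂) (h2 : r₂ < L) {y : ℝ → ℝ} (hyc : ContDiff ℝ ∞ y)
    (hy : tsupport y ⊆ Ioo (1 / X (m + 1) (r₂ / L)) (1 / X (m + 1) (r₁ / L))) {ζ ζ' : ℝ → ℝ}
    (hζ : ∀ s, HasDerivAt ζ (ζ' s) s) (hζc : ContDiff ℝ ∞ ζ) (hζ' : Continuous ζ')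
    {Ω : Set (EuclideanSpace ℝ (Fin n))}
    (hΩ : ∀ f : ℝ → ℝ, tsupport f ⊆ Ioo r₁ r₂ → tsupport (sepFun e f ζ) ⊆ Ω) :
    ∃ u, IsTestFunction Ω u ∧ ∃ J : ℕ → ℝ,
      (∀ i, logHardy Ω L i u = sphereInt e (fun s => ζ s ^ 2) * J i) ∧
      dirichlet Ω u = sphereInt e (fun s => ζ' s ^ 2 * (1 - s ^ 2)) * J 0
        + sphereInt e (fun s => ζ s ^ 2) * ((1 - n / 2) ^ 2 * J 0
          + 1 / 4 * ∑ i ∈ Finset.Icc 1 m, J i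
          + ∫ s in (1 / X (m + 1) (r₂ / L))..(1 / X (m + 1) (r₁ / L)), deriv y s ^ 2) ∧
      J m = ∫ s in (1 / X (m + 1) (r₂ / L))..(1 / X (m + 1) (r₁ / L)), y s ^ 2 ∧
      ∀ c d : ℝ, (∀ r ∈ Icc r₁ r₂, c ≤ d * prodX m (r / L) ^ 2) → c * J 0 ≤ d * J m := by
  set W := logPullback m L r₁ r₂ y with hW
  have hWs := tsupport_logPullback_subset h1 h2 hy
  have hWc := contDiff_logPullback h1 h2 hyc hy
  set f : ℝ → ℝ := fun r => W r * radialWeight n m L r with hf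
  have hfs : tsupport f ⊆ Ioo r₁ r₂ := tsupport_mul_subset_left.trans hWs
  have hfc : ContDiff ℝ ∞ f := contDiff_mul_of_tsupport_subset hWc hWs fun r hr =>
    contDiffAt_radialWeight n (h1.trans hr.1) (hr.2.trans h2)
  have hus := hΩ f hfs
  -- `J i` is the radial factor of the `i`-th logarithmic Hardy integral; `J 0` belongs to the Hardy
  -- term, and `J m` becomes `∫y²` in the variable `1/X_{m+1}`.
  set J : ℕ → ℝ := fun i =>
    ∫ r in r₁..r₂, prodX i (r / L) ^ 2 * (W r ^ 2 / (prodX m (r / L) * r)) with hJ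
  have hJ0 : J 0 = ∫ r in r₁..r₂, W r ^ 2 / (prodX m (r / L) * r) := by simp [hJ]
  have hpos : ∀ r ∈ Icc r₁ r₂, 0 < r ∧ r < L := fun r hr => ⟨h1.trans_le hr.1, hr.2.trans_lt h2⟩
  have hfsq : ∀ r ∈ Icc r₁ r₂,
      r ^ (n - 1) * (f r ^ 2 / r ^ 2) = W r ^ 2 / (prodX m (r / L) * r) := by
    intro r hr
    have := pow_mul_radialWeight_sq (m := m) hn (hpos r hr).1 (hpos r hr).2
    rw [hf]
    calc r ^ (n - 1) * ((W r * radialWeight n m L r) ^ 2 / r ^ 2)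
        = W r ^ 2 * (r ^ (n - 1) * (radialWeight n m L r ^ 2 / r ^ 2)) := by ring
      _ = _ := by rw [this]; ring
  have hW' : ∀ r, HasDerivAt W (deriv W r) r := fun r =>
    (hWc.differentiable (by simp) r).hasDerivAt
  have hfd : ∀ r ∈ Icc r₁ r₂, r ^ (n - 1) * deriv f r ^ 2
      = ((1 - n / 2 - sumX m (r / L) / 2) * W r + r * deriv W r) ^ 2 / (prodX m (r / L) * r) := by
    intro r hr
    obtain ⟨hr0, hrL⟩ := hpos r hr
    have h3 := pow_mul_radialWeight_sq (m := m) hn hr0 hrL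
    have h4 := ((hW' r).fun_mul (hasDerivAt_radialWeight (m := m) n hr0 hrL)).deriv
    rw [hf, h4]
    calc _ = ((1 - n / 2 - sumX m (r / L) / 2) * W r + r * deriv W r) ^ 2
          * (r ^ (n - 1) * (radialWeight n m L r ^ 2 / r ^ 2)) := by
          field_simp
          ring
      _ = _ := by rw [h3]; ring
  have hWr : ∀ r ∈ Icc r₁ r₂, W r = y (1 / X (m + 1) (r / L)) := fun r hr => logPullback_eq hy hr
  have hWd : ∀ r ∈ Icc r₁ r₂, deriv W r
      = deriv y (1 / X (m + 1) (r / L)) * -(prodX m (r / L) / r) := fun r hr =>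
    deriv_logPullback h1 h2 hyc hy hr
  have hI : ∀ g h : ℝ → ℝ, (∀ r ∈ Icc r₁ r₂, g r = h r) →
      ∫ r in r₁..r₂, g r = ∫ r in r₁..r₂, h r := fun g h hgh =>
    intervalIntegral.integral_congr (by rwa [uIcc_of_le h12])
  refine ⟨sepFun e f ζ, ⟨contDiff_sepFun h1 hfs hfc hζc,
    (hasCompactSupport_comp_norm hfs).mul_right, hus⟩, J, ?_, ?_, ?_, ?_⟩
  · intro i
    rw [logHardy_sepFun hn h1 h12 hfs hus]
    congr 1
    refine hI _ _ fun r hr => ?_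
    rw [← hfsq r hr]
    ring
  · rw [dirichlet_eq_integral hus, integral_norm_gradient_sepFun_sq hn he h1 h12 hfs hfc hζ hζ',
      hI _ _ hfsq, hI _ _ hfd, ← hJ0]
    rw [integral_radial_sq h1 h12 h2 hW' (hWc.continuous_deriv (by simp))
      (image_eq_zero_of_notMem_tsupport fun h => (hWs h).1.false)
      (image_eq_zero_of_notMem_tsupport fun h => (hWs h).2.false), ← hJ0,
      ← integral_comp_inv_X h1 h12 h2 (G := fun s => deriv y s ^ 2)
        ((hyc.continuous_deriv (by simp)).pow 2)]
    congr 3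
    refine hI _ _ fun r hr => ?_
    obtain ⟨hr0, hrL⟩ := hpos r hr
    have hp := prodX_div_pos m hr0 hrL
    rw [hWd r hr]
    field_simp
  · rw [hJ, ← integral_comp_inv_X h1 h12 h2 (G := fun s => y s ^ 2) (hyc.continuous.pow 2)]
    refine hI _ _ fun r hr => ?_
    obtain ⟨hr0, hrL⟩ := hpos r hr
    have hp := prodX_div_pos m hr0 hrL
    rw [hWr r hr]
    field_simp
  · intro c d hcd
    have hc1 : ContinuousOn (fun r => W r ^ 2 / (prodX m (r / L) * r)) (Icc r₁ r₂) :=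
      (hWc.continuous.continuousOn.pow 2).div ((continuousOn_prodX_div m h1 h2).mul continuousOn_id)
        fun r hr => (mul_pos (prodX_div_pos m (hpos r hr).1 (hpos r hr).2) (hpos r hr).1).ne'
    have ii : ∀ {g : ℝ → ℝ}, ContinuousOn g (Icc r₁ r₂) → IntervalIntegrable g volume r₁ r₂ :=
      fun hg => ContinuousOn.intervalIntegrable (by rwa [uIcc_of_le h12])
    rw [hJ0, hJ, ← intervalIntegral.integral_const_mul, ← intervalIntegral.integral_const_mul]
    refine intervalIntegral.integral_mono_on h12 (ii (continuousOn_const.mul hc1))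
      (ii (continuousOn_const.mul (((continuousOn_prodX_div m h1 h2).pow 2).mul hc1)))
      fun r hr => ?_
    rw [← mul_assoc]
    have := mul_pos (prodX_div_pos m (hpos r hr).1 (hpos r hr).2) (hpos r hr).1
    exact mul_le_mul_of_nonneg_right (hcd r hr) (by positivity)

/-- A smooth bump supported in `[1/4, 3/4]`. -/
noncomputable def unitBump : ContDiffBump (1 / 2 : ℝ) := ⟨1 / 8, 1 / 4, by norm_num, by norm_num⟩

lemma integral_unitBump_sq_pos : 0 < ∫ s in (0 : ℝ)..1, unitBump s ^ 2 := by
  refine intervalIntegral.integral_pos one_pos (unitBump.continuous.pow 2).continuousOn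
    (fun s _ => sq_nonneg _) ⟨1 / 2, ⟨by norm_num, by norm_num⟩, ?_⟩
  have : unitBump (1 / 2 : ℝ) = 1 :=
    unitBump.one_of_mem_closedBall (Metric.mem_closedBall_self unitBump.rIn_pos.le)
  rw [this]
  norm_num

/-- Stretching a fixed bump to length `N` divides the one-dimensional Rayleigh quotient by `N²`. -/
lemma exists_slow_profile {s₂ N : ℝ} (hN : 0 < N) : ∃ y : ℝ → ℝ, ContDiff ℝ ∞ y ∧
    tsupport y ⊆ Ioo s₂ (s₂ + N) ∧
    ∫ s in s₂..(s₂ + N), y s ^ 2 = N * ∫ s in (0 : ℝ)..1, unitBump s ^ 2 ∧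
    ∫ s in s₂..(s₂ + N), deriv y s ^ 2 = (∫ s in (0 : ℝ)..1, deriv unitBump s ^ 2) / N := by
  have hsc : ∀ g : ℝ → ℝ, ∫ s in s₂..(s₂ + N), g (s / N - s₂ / N) = N * ∫ s in (0 : ℝ)..1, g s := by
    intro g
    rw [intervalIntegral.integral_comp_div_sub g hN.ne', smul_eq_mul]
    congr 2
    · simp
    · field_simp
      ring
  refine ⟨fun s => unitBump (s / N - s₂ / N),
    unitBump.contDiff.comp ((contDiff_id.div_const N).sub contDiff_const), ?_,
    hsc fun s => unitBump s ^ 2, ?_⟩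
  · have hcl : IsClosed {s : ℝ | s / N - s₂ / N ∈ Icc (1 / 4 : ℝ) (3 / 4)} :=
      isClosed_Icc.preimage (by fun_prop)
    refine (closure_minimal (fun s hs => ?_) hcl).trans fun s hs => ?_
    · have h : s / N - s₂ / N ∈ Function.support unitBump := hs
      rw [unitBump.support_eq, Real.ball_eq_Ioo, show unitBump.rOut = 1 / 4 from rfl] at h
      constructor <;> linarith [h.1, h.2]
    · obtain ⟨ha, hb⟩ : 1 / 4 ≤ s / N - s₂ / N ∧ s / N - s₂ / N ≤ 3 / 4 := hs
      rw [← sub_div, le_div_iff₀ hN] at ha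
      rw [← sub_div, div_le_iff₀ hN] at hb
      constructor <;> linarith
  · have hd : ∀ s, deriv (fun s => unitBump (s / N - s₂ / N)) s
        = deriv unitBump (s / N - s₂ / N) / N := by
      intro s
      have h1 : HasDerivAt (fun s => s / N - s₂ / N) (1 / N) s :=
        ((hasDerivAt_id s).div_const N).sub_const _
      have h2 := HasDerivAt.comp (h₂ := unitBump) s ((unitBump.contDiff (n := 1)).differentiable
        one_ne_zero (s / N - s₂ / N)).hasDerivAt h1
      exact h2.deriv.trans (by ring)
    simp_rw [hd, div_pow]
    rw [hsc fun s => deriv unitBump s ^ 2 / N ^ 2, intervalIntegral.integral_div]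
    field_simp

/-- In a set with an interior ball at the origin the constant `1/4` cannot be improved. -/
theorem exists_quotient_le (hn : 1 ≤ n) {Ω : Set (EuclideanSpace ℝ (Fin n))}
    (hΩ : HasInteriorBall Ω) {L : ℝ} (hL : 0 < L) {m : ℕ} (hm : 1 ≤ m) {ε : ℝ} (hε : 0 < ε) :
    ∃ u, IsTestFunction Ω u ∧ u ≠ 0 ∧
      (dirichlet Ω u - (n : ℝ) ^ 2 / 4 * hardy Ω u
        - 1 / 4 * ∑ i ∈ Finset.Ico 1 m, logHardy Ω L i u) / logHardy Ω L m u ≤ 1 / 4 + ε := by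
  obtain ⟨r₀, hr₀, e, he, hball⟩ := hΩ
  obtain ⟨c₀, hc₀, hK⟩ := exists_sphereInt_angProfile_ge hn he
  set I₀ := ∫ s in (0 : ℝ)..1, unitBump s ^ 2 with hI₀
  set I₁ := ∫ s in (0 : ℝ)..1, deriv unitBump s ^ 2 with hI₁
  have hI₀pos : 0 < I₀ := integral_unitBump_sq_pos
  have hI₁nn : 0 ≤ I₁ := intervalIntegral.integral_nonneg zero_le_one fun s _ => sq_nonneg _
  set σ := sphereInt e (fun _ => 1) with hσ
  have hσ0 : 0 ≤ σ := sphereInt_nonneg e fun _ => zero_le_one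
  have hn' : (1 : ℝ) ≤ n := by exact_mod_cast hn
  -- The length is fixed first, so that `∫y'² ≤ (ε/2) ∫y²`; only afterwards is the support moved
  -- towards the origin.
  set N := 2 * I₁ / (I₀ * ε) + 1 with hN
  have hN1 : 1 ≤ N := by
    have : 0 ≤ 2 * I₁ / (I₀ * ε) := by positivity
    linarith
  have hN0 : 0 < N := by linarith
  have hNε : I₁ / N ≤ ε / 2 * (N * I₀) := by
    have h1 : 2 * I₁ ≤ N * (I₀ * ε) := by
      rw [hN, add_mul, div_mul_cancel₀ _ (by positivity)]
      have : 0 < I₀ * ε := by positivity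
      linarith
    rw [div_le_iff₀ hN0]
    nlinarith [mul_le_mul_of_nonneg_left hN1 (by positivity : 0 ≤ N * (I₀ * ε))]
  set C := (n - 1) * (4 * σ) * (L / r₀) with hC
  have hC0 : 0 ≤ C := by
    have : (0 : ℝ) ≤ n - 1 := by linarith
    positivity
  -- `C t₂ J 0` will bound the angular error. This `c` makes it at most `(ε/2) K₀ J m`; `C + 1`
  -- avoids dividing by a vanishing `C`.
  set c := c₀ * ε / (2 * (C + 1)) with hc
  have hcpos : 0 < c := by positivity
  have hev : ∀ᶠ t in 𝓝[>] (0 : ℝ), t ∈ Ioo 0 (min 1 (r₀ / L / 4)) :=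
    Ioo_mem_nhdsGT (by positivity)
  obtain ⟨t₂, hprod, ht₂⟩ :=
    ((eventually_le_prodX_sq (Real.exp_pos N) hm hcpos).and hev).exists
  obtain ⟨ht₂0, ht₂'⟩ := ht₂
  obtain ⟨ht₂1, ht₂4⟩ := lt_min_iff.1 ht₂'
  have hX₂ := X_pos (m + 1) ht₂0 ht₂1.le
  have hX₂1 : 1 ≤ 1 / X (m + 1) t₂ := (one_le_div hX₂).2 (X_le_one _ ht₂0 ht₂1.le)
  -- The inner radius is prescribed by requiring `1/X_{m+1}` to range over an interval of length
  -- exactly `N`.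
  obtain ⟨t₁, ht₁0, ht₁1, ht₁⟩ := exists_X_eq (m + 1) (y := 1 / (1 / X (m + 1) t₂ + N))
    (by positivity) ((div_le_one (by positivity)).2 (by linarith))
  have ht₁' : 1 / X (m + 1) t₁ = 1 / X (m + 1) t₂ + N := by rw [ht₁, one_div_one_div]
  have ht₁₂ : t₁ < t₂ := by
    by_contra h
    have h1 := X_le_X (m + 1) ht₂0 (not_lt.1 h) ht₁1
    have h2 := one_div_le_one_div_of_le hX₂ h1
    linarith
  have e₁ : t₁ * L / L = t₁ := mul_div_cancel_right₀ _ hL.ne'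
  have e₂ : t₂ * L / L = t₂ := mul_div_cancel_right₀ _ hL.ne'
  have hr12 : t₁ * L ≤ t₂ * L := by gcongr
  -- The opening parameter with `r₂ = r₀ a`, so that the truncated cone fits in the interior ball.
  -- It tends to zero with `t₂`, so the angular error is proportional to `t₂`.
  set a := t₂ * L / r₀ with ha
  have ha0 : 0 < a := by positivity
  have ha4 : a ≤ 1 / 4 := by
    rw [ha, div_le_iff₀ hr₀]
    have := (lt_div_iff₀ (by norm_num : (0 : ℝ) < 4)).1 ht₂4
    have := (lt_div_iff₀ hL).1 this
    linarith
  obtain ⟨y, hyc, hys, hy0, hy1⟩ := exists_slow_profile (s₂ := 1 / X (m + 1) t₂) hN0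
  obtain ⟨u, hu, J, hlog, hdir, hJm, hJ0⟩ := energies_sepFun hn he (m := m) (L := L)
    (r₁ := t₁ * L) (r₂ := t₂ * L) (by positivity) hr12 (by nlinarith) hyc
    (by rw [e₁, e₂, ht₁']; exact hys) (hasDerivAt_angProfile a) (contDiff_angProfile a)
    (contDiff_angStep a).continuous (Ω := Ω) fun f hf =>
      (tsupport_sepFun_subset_ball he (by positivity) hr₀ hf
        (fun s hs => angProfile_eq_zero ha0 hs) (by rw [ha]; field_simp; rfl)).trans hball
  rw [e₁, e₂, ht₁', hy0] at hJm
  rw [e₁, e₂, ht₁', hy1] at hdir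
  set K₀ := sphereInt e (fun s => angProfile a s ^ 2) with hK₀
  set K₁ := sphereInt e (fun s => angStep a s ^ 2 * (1 - s ^ 2)) with hK₁
  have hK₀c : c₀ ≤ K₀ := hK a ha0 ha4
  have hK₀0 : 0 < K₀ := hc₀.trans_le hK₀c
  have hK₁le : K₁ ≤ (n - 1) * (K₀ + 4 * a * σ) := sphereInt_angStep_le hn he ha0
  have hJmpos : 0 < J m := by rw [hJm]; positivity
  have hJ0nn : 0 ≤ J 0 := by
    have h1 := hlog 0
    have h2 := logHardy_nonneg Ω L 0 u
    rw [h1] at h2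
    exact nonneg_of_mul_nonneg_right h2 hK₀0
  have hkey : t₂ * J 0 ≤ c * J m := by
    refine hJ0 t₂ c fun r hr => ?_
    have hr1 : t₁ ≤ r / L := (le_div_iff₀ hL).2 hr.1
    have hr2 : r / L ≤ t₂ := (div_le_iff₀ hL).2 hr.2
    have hrpos := ht₁0.trans_le hr1
    have hrle := hr2.trans ht₂1.le
    refine hprod _ hrpos hrle (X_le_exp_mul_of_inv_le hrpos hrle ht₂0 ht₂1.le ?_)
    rw [← ht₁']
    exact one_div_le_one_div_of_le (X_pos _ ht₁0 ht₁1) (X_le_X _ ht₁0 hr1 hrle)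
  have herr : (K₁ - (n - 1) * K₀) * J 0 ≤ ε / 2 * (K₀ * J m) := by
    calc (K₁ - (n - 1) * K₀) * J 0 ≤ ((n - 1) * (4 * a * σ)) * J 0 := by
          gcongr
          linarith
      _ = C * (t₂ * J 0) := by rw [hC, ha]; ring
      _ ≤ C * (c * J m) := by gcongr
      _ ≤ (C + 1) * (c * J m) := by gcongr; linarith
      _ = ε / 2 * (c₀ * J m) := by rw [hc]; field_simp
      _ ≤ ε / 2 * (K₀ * J m) := by gcongr
  refine ⟨u, hu, ?_, ?_⟩
  · rintro rfl
    have h1 := hlog m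
    have h2 : logHardy Ω L m 0 = 0 := by simp [logHardy]
    rw [h2] at h1
    exact (mul_pos hK₀0 hJmpos).ne h1
  · rw [hlog m, div_le_iff₀ (mul_pos hK₀0 hJmpos), hardy_eq_logHardy Ω L, hlog 0, hdir,
      Finset.sum_congr rfl fun i _ => hlog i, ← Finset.mul_sum]
    have hsum : ∑ i ∈ Finset.Icc 1 m, J i = ∑ i ∈ Finset.Ico 1 m, J i + J m :=
      Finset.sum_Ico_succ_top hm J
    rw [hsum]
    have h3 : K₀ * (I₁ / N) ≤ K₀ * (ε / 2 * J m) := by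
      rw [hJm]
      gcongr
    generalize ∑ i ∈ Finset.Ico 1 m, J i = S
    -- The identity `(n - 1) + (1 - n/2)² = n²/4` cancels the leading Hardy term, leaving the
    -- angular error, the energy of `y`, and the expected `1/4`.
    calc _ = (K₁ - (n - 1) * K₀) * J 0 + K₀ * (I₁ / N) + 1 / 4 * (K₀ * J m) := by ring
      _ ≤ _ := by linarith

end HardyBoundary

/-! ### Assembly of the theorem -/

open HardyBoundary in
theorem theorem1p3 :
    (∃! κ : ℝ, IsKappa κ) ∧
    ∀ κ : ℝ, IsKappa κ → ∀ n : ℕ, 2 ≤ n →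
      ∃ σ : ℝ, 0 < σ ∧
        ∀ Ω : Set (EuclideanSpace ℝ (Fin n)), IsBoundedDomain Ω → 0 ∈ frontier Ω →
          ∀ ρ : ℝ, HasExteriorBall Ω ρ → supNorm Ω / σ ≤ ρ →
            (∀ u : EuclideanSpace ℝ (Fin n) → ℝ, IsTestFunction Ω u →
              Summable (fun i : ℕ => logHardy Ω (3 * κ * supNorm Ω) (i + 1) u) ∧
              (n : ℝ) ^ 2 / 4 * hardy Ω u
                  + 1 / 4 * ∑' i : ℕ, logHardy Ω (3 * κ * supNorm Ω) (i + 1) u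
                ≤ dirichlet Ω u) ∧
            (HasInteriorBall Ω → ∀ m : ℕ, 1 ≤ m →
              IsGLB
                {q : ℝ | ∃ u : EuclideanSpace ℝ (Fin n) → ℝ, IsTestFunction Ω u ∧ u ≠ 0 ∧
                  q = (dirichlet Ω u - (n : ℝ) ^ 2 / 4 * hardy Ω u
                        - 1 / 4 * ∑ i ∈ Finset.Ico 1 m, logHardy Ω (3 * κ * supNorm Ω) i u)
                      / logHardy Ω (3 * κ * supNorm Ω) m u}
                (1 / 4)) := by
  refine ⟨?_, fun κ hκ n hn2 => ?_⟩
  · obtain ⟨κ, hκ⟩ := exists_isKappa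
    exact ⟨κ, hκ, fun κ' hκ' => hκ'.unique hκ⟩
  have hn : 1 ≤ n := by omega
  have hn0 : (0 : ℝ) < n := by exact_mod_cast hn
  refine ⟨1 / (8 * n * (n + 4)), by positivity, fun Ω hΩ h0 ρ hρ hσ =>
    ⟨fun u hu => summable_logHardy_and_le hκ hn hΩ h0 hρ hσ hu, fun hint m hm => ⟨?_, ?_⟩⟩⟩
  -- The bound from below is the inequality with `m` logarithmic terms, divided by the last one,
  -- which is positive for `u ≠ 0`.
  · rintro q ⟨u, hu, hne, rfl⟩
    have hpos := logHardy_pos (fun x hx => norm_mem_of_isKappa hκ hΩ h0 hx) m hu hne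
    have h := hardy_add_sum_logHardy_le hκ hn hΩ h0 hρ hσ hu m
    have hsum : ∑ i ∈ Finset.Icc 1 m, logHardy Ω (3 * κ * supNorm Ω) i u
        = ∑ i ∈ Finset.Ico 1 m, logHardy Ω (3 * κ * supNorm Ω) i u
          + logHardy Ω (3 * κ * supNorm Ω) m u := Finset.sum_Ico_succ_top hm _
    rw [hsum] at h
    rw [le_div_iff₀ hpos]
    linarith
  · intro b hb
    refine le_of_forall_pos_le_add fun ε hε => ?_
    have hκ1 := hκ.1
    have hD := supNorm_pos hΩ h0
    obtain ⟨u, hu, hne, hq⟩ := exists_quotient_le hn hint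
      (L := 3 * κ * supNorm Ω) (by positivity) hm hε
    exact (hb ⟨u, hu, hne, rfl⟩).trans hq
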